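/- Let $G$ be a discrete group. A complex Banach $*$-algebra $B$ is called symmetric if for every $b\in B$ the spectrum of $b^*b$ (computed in the unitization if $B$ has no unit) is contained in $[0,\infty)$. The group $G$ is called rigidly symmetric if for every $C^*$-algebra $\mathcal B$ the Banach $*$-algebra $\ell^1(G;\mathcal B)\cong \ell^1(G)\,\widehat\otimes\,\mathcal B$, with product $(f*g)(x)=\sum_{y\in G}f(y)g(y^{-1}x)$ and involution $f^*(x)=f(x^{-1})^*$, is symmetric. Let $\mathcal A=\mathcal A(G)$ be a unital $C^*$-subalgebra of $\ell^\infty(G)$ (closed and containing the constants) that is invariant under the translations $[\alpha_x(\varphi)](y):=\varphi(x^{-1}y)$, $x\in G$. Let $\omega:G\times G\to\mathcal A$ be an $\mathcal A$-valued $2$-cocycle, i.e. each $\omega(x,y)$ is a unitary element of $\mathcal A$ and, for all $x,y,z\in G$, $$\omega(x,y)\,\omega(xy,z)=\alpha_x[\omega(y,z)]\,\omega(x,yz),\qquad \omega(x,e)=1=\omega(e,x).$$ Write $\omega(x,y;z):=[\omega(x,y)](z)$ and $\lambda(x,y):=\omega(x^{-1},xy^{-1};e)$. Let $\mathfrak K^{\mathcal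 A}_\omega(G\times G)$ be the set of all kernels $K:G\times G\to\mathbb C$ such that there is $k\in\ell^1(G)$ with $|K(x,y)|\le|k(xy^{-1})|$ for all $x,y\in G$, and such that for all $x,y\in G$ the function $z\mapsto K(xz,yz)$ belongs to $\mathcal A$. Assume that $G$ is amenable and rigidly symmetric. Then for every $K\in\mathfrak K^{\mathcal A}_\omega(G\times G)$ the formula $$[\mathrm{Int}_\lambda(K)v](x)=\sum_{y\in G}K(x,y)\,\lambda(x,y)\,v(y),\qquad v\in\ell^2(G),\ x\in G,$$ defines a bounded operator on $\ell^2(G)$, and the set of twisted integral operators $$\mathbb I^{\mathcal A}_\lambda(G):=\{\mathrm{Int}_\lambda(K): K\in\mathfrak K^{\mathcal A}_\omega(G\times G)\}$$ is a unital $*$-subalgebra of $\mathbb B[\ell^2(G)]$ with the following two properties. 1. It is inverse closed: if $T\in\mathbb I^{\mathcal A}_\lambda(G)$ is invertible in $\mathbb B[\ell^2(G)]$, then $T^{-1}\in\mathbb I^{\mathcal A}_\lambda(G)$. 2. It is Fredholm inverse closed: for every Fredholm operator $T\in\mathbb I^{\mathcal A}_\lambda(G)$ there exists $S\in\mathbb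 I^{\mathcal A}_\lambda(G)$ such that $ST-1$ and $TS-1$ are compact operators. -/

import Mathlib

open scoped ENNReal

noncomputable section

/-! ### Symmetric Banach `*`-algebras and rigidly symmetric groups -/

/-- A complex `*`-algebra `B` (in practice a Banach `*`-algebra, possibly without unit) is
*symmetric* if the spectrum of `b* b` is contained in `[0, ∞)` for every `b`. For algebras without
unit the spectrum is the one computed in the unitization, which is Mathlib's `quasispectrum`; for
unital algebras it only differs from the usual one by the point `0`. -/
def IsSymmetricStarAlgebra (B : Type*) [NonUnitalRing B] [Module ℂ B] [Star B] : Prop :=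
  ∀ b : B, ∀ z ∈ quasispectrum ℂ (star b * b), 0 ≤ z.re ∧ z.im = 0

/-- The Banach space `ℓ¹(G; A)` of absolutely summable functions `G → A`. It is a separate type
since it carries the convolution product and the convolution involution. -/
def EllOne (G A : Type*) [NormedAddCommGroup A] : Type _ := lp (fun _ : G => A) 1

namespace EllOne

variable {G A : Type*}

section Basic

variable [NormedAddCommGroup A]

instance : NormedAddCommGroup (EllOne G A) :=
  inferInstanceAs (NormedAddCommGroup (lp (fun _ : G => A) 1))

instance [NormedSpace ℂ A] : NormedSpace ℂ (EllOne G A) :=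
  inferInstanceAs (NormedSpace ℂ (lp (fun _ : G => A) 1))

instance : FunLike (EllOne G A) G A where
  coe f := f.1
  coe_injective _ _ h := Subtype.ext h

theorem memlp_one_iff {f : G → A} :
    Memℓp (E := fun _ : G => A) f 1 ↔ Summable fun x => ‖f x‖ := by
  have h : 0 < (1 : ℝ≥0∞).toReal := by norm_num
  simpa using memℓp_gen_iff (E := fun _ : G => A) (f := f) h

theorem summable_norm (f : EllOne G A) : Summable fun x => ‖f x‖ := memlp_one_iff.1 f.2

/-- The element of `ℓ¹(G; A)` given by an absolutely summable function. -/
def mk (f : G → A) (hf : Summable fun x => ‖f x‖) : EllOne G A := ⟨f, memlp_one_iff.2 hf⟩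

@[simp] theorem mk_apply (f : G → A) (hf : Summable fun x => ‖f x‖) (x : G) : mk f hf x = f x := rfl

@[ext] theorem ext {f g : EllOne G A} (h : ∀ x, f x = g x) : f = g := DFunLike.ext f g h

@[simp] theorem add_apply (f g : EllOne G A) (x : G) : (f + g) x = f x + g x := rfl

@[simp] theorem zero_apply (x : G) : (0 : EllOne G A) x = 0 := rfl

@[simp] theorem smul_apply [NormedSpace ℂ A] (c : ℂ) (f : EllOne G A) (x : G) :
    (c • f) x = c • f x := rfl

theorem norm_eq_tsum (f : EllOne G A) : ‖f‖ = ∑' x, ‖f x‖ := by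
  have h : 0 < (1 : ℝ≥0∞).toReal := by norm_num
  have h' := lp.norm_eq_tsum_rpow (E := fun _ : G => A) h f
  simp only [ENNReal.toReal_one, Real.rpow_one, div_one] at h'
  exact h'

theorem norm_apply_le (f : EllOne G A) (x : G) : ‖f x‖ ≤ ‖f‖ := by
  rw [norm_eq_tsum]
  exact f.summable_norm.le_tsum x fun _ _ => norm_nonneg _

end Basic

section Star

variable [Group G] [NonUnitalNormedRing A] [StarRing A] [NormedStarGroup A]

/-- The involution `f*(x) = f(x⁻¹)*`. -/
instance : Star (EllOne G A) where
  star f := mk (fun x => star (f x⁻¹)) (by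
    simp only [norm_star]
    exact (Equiv.inv G).summable_iff.2 f.summable_norm)

@[simp] theorem star_apply (f : EllOne G A) (x : G) : star f x = star (f x⁻¹) := rfl

end Star

section Convolution

variable [Group G] [NonUnitalNormedRing A]

/-- The bijection `(x, y) ↦ (y, y⁻¹ x)` of `G × G`. -/
def shear (G : Type*) [Group G] : G × G ≃ G × G where
  toFun p := (p.2, p.2⁻¹ * p.1)
  invFun p := (p.1 * p.2, p.1)
  left_inv p := by simp
  right_inv p := by simp

theorem summable_prod (f g : EllOne G A) :
    Summable fun p : G × G => ‖f p.2‖ * ‖g (p.2⁻¹ * p.1)‖ :=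
  (shear G).summable_iff.2
    (f.summable_norm.mul_of_nonneg g.summable_norm (fun _ => norm_nonneg _) fun _ => norm_nonneg _)

theorem summable_norm_conv (f g : EllOne G A) (x : G) :
    Summable fun y => ‖f y * g (y⁻¹ * x)‖ :=
  ((summable_prod f g).prod_factor x).of_nonneg_of_le (fun _ => norm_nonneg _)
    fun _ => norm_mul_le _ _

theorem norm_conv_le (f g : EllOne G A) (x : G) :
    ‖∑' y, f y * g (y⁻¹ * x)‖ ≤ ∑' y, ‖f y‖ * ‖g (y⁻¹ * x)‖ :=
  (norm_tsum_le_tsum_norm (summable_norm_conv f g x)).trans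
    ((summable_norm_conv f g x).tsum_le_tsum (fun _ => norm_mul_le _ _)
      ((summable_prod f g).prod_factor x))

/-- Convolution, `(f * g)(x) = ∑ y, f(y) g(y⁻¹ x)`. -/
instance : Mul (EllOne G A) where
  mul f g := mk (fun x => ∑' y, f y * g (y⁻¹ * x))
    ((summable_prod f g).prod.of_nonneg_of_le (fun _ => norm_nonneg _) (norm_conv_le f g))

theorem mul_apply (f g : EllOne G A) (x : G) : (f * g) x = ∑' y, f y * g (y⁻¹ * x) := rfl

theorem norm_mul_le' (f g : EllOne G A) : ‖f * g‖ ≤ ‖f‖ * ‖g‖ := by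
  rw [norm_eq_tsum, norm_eq_tsum f, norm_eq_tsum g]
  calc ∑' x, ‖(f * g) x‖ ≤ ∑' x, ∑' y, ‖f y‖ * ‖g (y⁻¹ * x)‖ :=
        (f * g).summable_norm.tsum_le_tsum (norm_conv_le f g) (summable_prod f g).prod
    _ = ∑' p : G × G, ‖f p.2‖ * ‖g (p.2⁻¹ * p.1)‖ := (summable_prod f g).tsum_prod.symm
    _ = ∑' p : G × G, ‖f p.1‖ * ‖g p.2‖ :=
        (shear G).tsum_eq fun p : G × G => ‖f p.1‖ * ‖g p.2‖
    _ = (∑' x, ‖f x‖) * ∑' x, ‖g x‖ :=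
        (f.summable_norm.tsum_mul_tsum g.summable_norm
          (f.summable_norm.mul_of_nonneg g.summable_norm (fun _ => norm_nonneg _)
            fun _ => norm_nonneg _)).symm

variable [CompleteSpace A]

theorem summable_conv (f g : EllOne G A) (x : G) : Summable fun y => f y * g (y⁻¹ * x) :=
  (summable_norm_conv f g x).of_norm

theorem summable_triple (f g h : EllOne G A) (x : G) :
    Summable fun p : G × G => f p.2 * g (p.2⁻¹ * p.1) * h (p.1⁻¹ * x) := by
  refine Summable.of_norm_bounded ((summable_prod f g).mul_right ‖h‖) fun p => ?_
  exact (norm_mul_le _ _).trans (mul_le_mul (norm_mul_le _ _) (norm_apply_le _ _)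
    (norm_nonneg _) (mul_nonneg (norm_nonneg _) (norm_nonneg _)))

theorem conv_assoc (f g h : EllOne G A) : f * g * h = f * (g * h) := by
  ext x
  have h1 : (f * g * h) x = ∑' y, ∑' z, f z * g (z⁻¹ * y) * h (y⁻¹ * x) := by
    rw [mul_apply]
    refine tsum_congr fun y => ?_
    rw [mul_apply]
    exact ((summable_conv f g y).tsum_mul_right (h (y⁻¹ * x))).symm
  have h2 : (f * (g * h)) x = ∑' z, ∑' y, f z * g (z⁻¹ * y) * h (y⁻¹ * x) := by
    rw [mul_apply]
    refine tsum_congr fun z => ?_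
    rw [mul_apply]
    refine ((summable_conv g h (z⁻¹ * x)).tsum_mul_left (f z)).symm.trans ?_
    rw [← (Equiv.mulLeft z).tsum_eq fun y => f z * g (z⁻¹ * y) * h (y⁻¹ * x)]
    refine tsum_congr fun w => ?_
    rw [Equiv.coe_mulLeft, inv_mul_cancel_left, mul_inv_rev, mul_assoc w⁻¹, mul_assoc]
  rw [h1, h2]
  exact (Summable.tsum_comm (f := fun y z => f z * g (z⁻¹ * y) * h (y⁻¹ * x))
    (summable_triple f g h x)).symm

instance : NonUnitalNormedRing (EllOne G A) where
  toNorm := inferInstance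
  __ := (inferInstance : NormedAddCommGroup (EllOne G A))
  mul := (· * ·)
  left_distrib f g h := by
    ext x
    simp only [mul_apply, add_apply, mul_add]
    exact (summable_conv f g x).tsum_add (summable_conv f h x)
  right_distrib f g h := by
    ext x
    simp only [mul_apply, add_apply, add_mul]
    exact (summable_conv f h x).tsum_add (summable_conv g h x)
  zero_mul f := by ext x; simp [mul_apply]
  mul_zero f := by ext x; simp [mul_apply]
  mul_assoc := conv_assoc
  norm_mul_le := norm_mul_le'

instance [NormedSpace ℂ A] [IsScalarTower ℂ A A] : IsScalarTower ℂ (EllOne G A) (EllOne G A) where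
  smul_assoc c f g := by
    ext x
    simp only [smul_eq_mul, mul_apply, smul_apply, smul_mul_assoc]
    exact (summable_conv f g x).tsum_const_smul c

instance [NormedSpace ℂ A] [SMulCommClass ℂ A A] : SMulCommClass ℂ (EllOne G A) (EllOne G A) where
  smul_comm c f g := by
    ext x
    simp only [smul_eq_mul, mul_apply, smul_apply, mul_smul_comm]
    exact ((summable_conv f g x).tsum_const_smul c).symm

instance [StarRing A] [NormedStarGroup A] : StarRing (EllOne G A) where
  star_involutive f := by ext x; simp only [star_apply, inv_inv, star_star]
  star_add f g := by ext x; simp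
  star_mul f g := by
    ext x
    rw [star_apply, mul_apply, mul_apply, tsum_star,
      ← (Equiv.mulLeft x).tsum_eq fun y => star g y * star f (y⁻¹ * x)]
    exact tsum_congr fun w => by simp [star_mul]

end Convolution

end EllOne

/-- A discrete group `G` is *rigidly symmetric* if the Banach `*`-algebra `ℓ¹(G; A)`, that is the
projective tensor product of `ℓ¹(G)` and `A`, is symmetric for every C⋆-algebra `A`
(unital or not). -/
def IsRigidlySymmetric.{u} (G : Type u) [Group G] : Prop :=
  ∀ (A : Type u) [NonUnitalCStarAlgebra A], IsSymmetricStarAlgebra (EllOne G A)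

/-! ### Bounded functions, translations, amenability, cocycles -/

/-- The C⋆-algebra `ℓ^∞(G)`. -/
abbrev EllInfty (G : Type*) := lp (fun _ : G => ℂ) ∞

/-- The Hilbert space `ℓ²(G)`. -/
abbrev EllTwo (G : Type*) := lp (fun _ : G => ℂ) 2

section Group

variable {G : Type*} [Group G]

/-- The action of `G` on `ℓ^∞(G)`: `[α_x(φ)](y) = φ(x⁻¹ y)`. -/
def leftTranslate (x : G) (φ : EllInfty G) : EllInfty G :=
  ⟨fun y => φ (x⁻¹ * y), memℓp_infty ⟨‖φ‖, by
    rintro _ ⟨y, rfl⟩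
    exact lp.norm_apply_le_norm ENNReal.top_ne_zero φ _⟩⟩

/-- `G` is *amenable* as a discrete group: there is a left invariant mean on `ℓ^∞(G)`. -/
def IsAmenableGroup (G : Type*) [Group G] : Prop :=
  ∃ m : EllInfty G →ₗ[ℂ] ℂ, m 1 = 1 ∧
    (∀ φ : EllInfty G, (∀ x, 0 ≤ (φ x).re ∧ (φ x).im = 0) → 0 ≤ (m φ).re ∧ (m φ).im = 0) ∧
    ∀ (x : G) (φ : EllInfty G), m (leftTranslate x φ) = m φ

/-- Normalized unitary-valued `2`-cocycles with respect to the action by left translations. -/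
structure IsTwoCocycle (ω : G → G → EllInfty G) : Prop where
  mem_unitary : ∀ x y, ω x y ∈ unitary (EllInfty G)
  cocycle : ∀ x y z, ω x y * ω (x * y) z = leftTranslate x (ω y z) * ω x (y * z)
  map_one_right : ∀ x, ω x 1 = 1
  map_one_left : ∀ x, ω 1 x = 1

/-! ### Twisted integral operators -/

/-- The space of scalar kernels `K` on `G × G` which are dominated by an `ℓ¹`-function of `x y⁻¹`
and for which all the functions `z ↦ K(xz, yz)` belong to `A ⊆ ℓ^∞(G)`. -/
def twistedKernels (A : StarSubalgebra ℂ (EllInfty G)) : Set (G → G → ℂ) :=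
  {K | (∃ k : EllOne G ℂ, ∀ x y, ‖K x y‖ ≤ ‖k (x * y⁻¹)‖) ∧
    ∀ x y, ∃ φ ∈ A, ∀ z, φ z = K (x * z) (y * z)}

/-- The phase factor `λ(x, y) = ω(x⁻¹, x y⁻¹; e)`. -/
def twistPhase (ω : G → G → EllInfty G) (x y : G) : ℂ := ω x⁻¹ (x * y⁻¹) 1

/-- The bounded operator `T` on `ℓ²(G)` is the twisted integral operator with kernel `K`:
`(T v)(x) = ∑ y, K(x, y) λ(x, y) v(y)` (unconditionally convergent) for all `v` and `x`. -/
def IsTwistedIntegralOperator (ω : G → G → EllInfty G) (K : G → G → ℂ)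
    (T : EllTwo G →L[ℂ] EllTwo G) : Prop :=
  ∀ (v : EllTwo G) (x : G), HasSum (fun y => K x y * twistPhase ω x y * v y) (T v x)

/-- The set of all twisted integral operators with kernels in `twistedKernels A`. -/
def twistedIntegralOperators (A : StarSubalgebra ℂ (EllInfty G)) (ω : G → G → EllInfty G) :
    Set (EllTwo G →L[ℂ] EllTwo G) :=
  {T | ∃ K ∈ twistedKernels A, IsTwistedIntegralOperator ω K T}

end Group

/-! ### Inverse closed and Fredholm inverse closed subalgebras -/

/-- A `*`-subalgebra `B` of `C` is *inverse closed* if the inverse of every element of `B` that is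
invertible in `C` belongs to `B`. -/
def IsInverseClosed {C : Type*} [Ring C] [StarRing C] [Algebra ℂ C] [StarModule ℂ C]
    (B : StarSubalgebra ℂ C) : Prop :=
  ∀ f ∈ B, ∀ g : C, f * g = 1 → g * f = 1 → g ∈ B

/-- A `*`-subalgebra `F` of `𝔹(H)` is *Fredholm inverse closed* if every Fredholm operator `T ∈ F`
has an inverse modulo compact operators that belongs to `F`. -/
def IsFredholmInverseClosed {H : Type*} [NormedAddCommGroup H] [InnerProductSpace ℂ H]
    [CompleteSpace H] (F : StarSubalgebra ℂ (H →L[ℂ] H)) : Prop :=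
  ∀ T ∈ F, T.IsFredholm → ∃ S ∈ F,
    IsCompactOperator (S * T - 1 : H →L[ℂ] H) ∧ IsCompactOperator (T * S - 1 : H →L[ℂ] H)

end

/-! The operator with kernel supported on the diagonal `x * y⁻¹ = a` is a weighted shift, and the
norm of its coefficient function equals its own norm. Hence the twisted integral operators are the
image under `EllOne.sumHom` of a closed `*`-subalgebra D of `ℓ¹(G; 𝔹(ℓ²(G)))`, whose members have as
value at `a` an operator on the `a`-th diagonal (`mem_twistedIntegralOperators_iff`). Both
properties follow once D is spectrally invariant: `h` is invertible in D as soon as its sum is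
invertible on `ℓ²(G)` (`isUnit_of_sumHom`).

For spectral invariance, let `h*h` sum to an operator bounded below by `δ > 0`, so that `x = h*h -
δ` sums to a positive operator. After inflating by the multiplicity space `ℓ²(List G)`, compressing
this sum by suitable co-isometries recovers each value of `x`. Multiplying `x` by a finitely
supported coefficient of the regular representation therefore gives exactly an element `C*C`
(`exists_star_mul_self_eq_regularCoeff`). Amenability lets these coefficients tend to 1
(`IsAmenableGroup.exists_regularCoeff`), so the inflated `x` is a norm limit of elements `C*C`.
Rigid symmetry then makes `x + t` invertible for every `t > 0`
(`IsSymmetricStarAlgebra.isUnit_add_of_approx`) and the spectrum of `h*h` lies in `[δ, ∞)`.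
Consequently some power of `1 - c⁻¹ h*h` has norm below 1. This is a statement about norms only, so
it survives in D, where a Neumann series inverts `h*h`
(`IsSymmetricStarAlgebra.isUnit_star_mul_self`). The same for `hh*` yields a two-sided inverse of
`h`.

For a Fredholm `T`, the operator `T*T` has a generalized inverse `b`, with `T*T b = b T*T = 1 - p`
for the finite-rank projection `p` onto the kernel. It is a contour integral of the resolvent around
0. By spectral invariance this integral can be formed inside D, so `b T*` is the required inverse
modulo compact operators (`EllOne.exists_fredholm_inverse`). -/

noncomputable section

set_option linter.unusedSectionVars false

/-! ### The unital Banach `*`-algebra `ℓ¹(G; A)` -/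

namespace EllOne

variable {G A B : Type*}

section NormedGroup

variable [NormedAddCommGroup A]

@[simp] theorem sub_apply (f g : EllOne G A) (x : G) : (f - g) x = f x - g x := rfl

instance [CompleteSpace A] : CompleteSpace (EllOne G A) :=
  inferInstanceAs (CompleteSpace (lp (fun _ : G => A) 1))

open Classical in
/-- The function supported at the point `a` with value `b`. -/
def single (a : G) (b : A) : EllOne G A :=
  mk (fun x => if x = a then b else 0)
    (summable_of_ne_finset_zero (s := {a}) fun x hx => by
      simp only [Finset.mem_singleton] at hx
      simp [hx])

open Classical in
theorem single_apply (a : G) (b : A) (x : G) : single a b x = if x = a then b else 0 := rfl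

theorem single_apply_self (a : G) (b : A) : single a b a = b := by simp [single_apply]

theorem single_apply_ne {a x : G} (h : x ≠ a) (b : A) : single a b x = 0 := by
  simp [single_apply, h]

theorem summable [CompleteSpace A] (f : EllOne G A) : Summable f := f.summable_norm.of_norm

theorem lipschitzWith_apply (x : G) : LipschitzWith 1 fun f : EllOne G A => f x :=
  LipschitzWith.of_dist_le_mul fun f g => by
    simpa [dist_eq_norm] using norm_apply_le (f - g) x

theorem continuous_apply (x : G) : Continuous fun f : EllOne G A => f x :=
  (lipschitzWith_apply x).continuous

theorem finset_sum_apply {ι : Type*} (s : Finset ι) (f : ι → EllOne G A) (x : G) :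
    (∑ i ∈ s, f i) x = ∑ i ∈ s, f i x := by
  classical
  induction s using Finset.induction_on with
  | empty => simp
  | insert i s hi ih => simp [Finset.sum_insert hi, ih]

/-- Finitely many values carry almost all the norm. -/
theorem exists_finset_sum_norm_lt (f : EllOne G A) {ε : ℝ} (hε : 0 < ε) :
    ∃ s : Finset G, ‖f‖ - ∑ x ∈ s, ‖f x‖ < ε := by
  have h := f.summable_norm.hasSum
  rw [← norm_eq_tsum] at h
  obtain ⟨s, hs⟩ := (h.eventually (lt_mem_nhds (sub_lt_self ‖f‖ hε))).exists
  exact ⟨s, by linarith⟩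

end NormedGroup

section Ring

variable [Group G]

theorem single_mul_single [NonUnitalNormedRing A] (a b : G) (u v : A) :
    single a u * single b v = single (a * b) (u * v) := by
  ext x
  rw [mul_apply, tsum_eq_single a]
  · by_cases h : x = a * b
    · subst h
      simp [single_apply]
    · have h' : a⁻¹ * x ≠ b := fun h' => h (by rw [← h', mul_inv_cancel_left])
      simp [single_apply, h, h']
  · intro y hy
    simp [single_apply, hy]

theorem star_single [NonUnitalNormedRing A] [StarRing A] [NormedStarGroup A] (a : G) (u : A) :
    star (single a u) = single a⁻¹ (star u) := by
  ext x
  by_cases h : x = a⁻¹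
  · subst h
    simp [single_apply]
  · have h' : x⁻¹ ≠ a := fun h' => h (by rw [← h', inv_inv])
    simp [single_apply, h, h']

variable [NormedRing A]

instance : One (EllOne G A) := ⟨single 1 1⟩

theorem one_apply_one : (1 : EllOne G A) 1 = 1 := single_apply_self _ _

theorem one_apply_ne {x : G} (h : x ≠ 1) : (1 : EllOne G A) x = 0 := single_apply_ne h _

variable [CompleteSpace A]

instance : NormedRing (EllOne G A) where
  __ := (inferInstance : NonUnitalNormedRing (EllOne G A))
  one := 1
  one_mul f := by
    ext x
    rw [mul_apply, tsum_eq_single 1]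
    · simp [one_apply_one]
    · intro y hy
      simp [one_apply_ne hy]
  mul_one f := by
    ext x
    rw [mul_apply, tsum_eq_single x]
    · simp [one_apply_one]
    · intro y hy
      have : y⁻¹ * x ≠ 1 := fun h => hy (by rw [inv_mul_eq_one] at h; exact h)
      simp [one_apply_ne this]

variable [NormedAlgebra ℂ A]

instance : Algebra ℂ (EllOne G A) :=
  Algebra.ofModule (fun c f g => smul_mul_assoc c f g) (fun c f g => mul_smul_comm c f g)

instance : NormedAlgebra ℂ (EllOne G A) where
  norm_smul_le c f := norm_smul_le c f

end Ring

section Star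

variable [Group G] [NormedRing A] [CompleteSpace A] [StarRing A] [NormedStarGroup A]

instance : NormedStarGroup (EllOne G A) where
  norm_star_le f := by
    rw [norm_eq_tsum, norm_eq_tsum]
    simp only [star_apply, norm_star]
    exact ((Equiv.inv G).tsum_eq fun x => ‖f x‖).le

instance [NormedAlgebra ℂ A] [StarModule ℂ A] : StarModule ℂ (EllOne G A) where
  star_smul c f := by ext x; simp

end Star

section SumHom

variable [Group G] [NormedRing A] [CompleteSpace A] [NormedAlgebra ℂ A] [StarRing A]
  [NormedStarGroup A] [StarModule ℂ A]

/-- The unital `*`-homomorphism `ℓ¹(G; A) → A` summing the values of a function. -/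
def sumHom : EllOne G A →⋆ₐ[ℂ] A where
  toFun f := ∑' x, f x
  map_one' := by
    rw [tsum_eq_single 1 fun x hx => one_apply_ne hx, one_apply_one]
  map_zero' := by simp
  map_add' f g := by simpa using f.summable.tsum_add g.summable
  map_mul' f g := by
    rw [tsum_mul_tsum_of_summable_norm f.summable_norm g.summable_norm,
      ← (shear G).tsum_eq fun p : G × G => f p.1 * g p.2]
    have h : Summable fun p : G × G => f p.2 * g (p.2⁻¹ * p.1) :=
      Summable.of_norm_bounded (summable_prod f g) fun p => norm_mul_le _ _
    exact h.tsum_prod.symm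
  commutes' c := by
    rw [Algebra.algebraMap_eq_smul_one, tsum_eq_single 1, smul_apply, one_apply_one,
      Algebra.algebraMap_eq_smul_one]
    intro x hx
    rw [smul_apply, one_apply_ne hx, smul_zero]
  map_star' f := by
    simp only [star_apply]
    rw [tsum_star]
    exact (Equiv.inv G).tsum_eq fun x => star (f x)

theorem hasSum_sumHom (f : EllOne G A) : HasSum f (sumHom f) := f.summable.hasSum

theorem norm_sumHom_le (f : EllOne G A) : ‖sumHom f‖ ≤ ‖f‖ := by
  rw [norm_eq_tsum]
  exact norm_tsum_le_tsum_norm f.summable_norm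

theorem continuous_sumHom : Continuous (sumHom : EllOne G A → A) :=
  (LipschitzWith.of_dist_le_mul (K := 1) fun f g => by
    simpa [dist_eq_norm, ← map_sub] using norm_sumHom_le (f - g)).continuous

end SumHom

section MapHom

variable [Group G] [NormedRing A] [CompleteSpace A] [NormedAlgebra ℂ A] [StarRing A]
  [NormedStarGroup A] [StarModule ℂ A] [NormedRing B] [CompleteSpace B] [NormedAlgebra ℂ B]
  [StarRing B] [NormedStarGroup B] [StarModule ℂ B]

/-- The `*`-homomorphism `ℓ¹(G; A) → ℓ¹(G; B)` induced by an isometric `*`-homomorphism. -/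
def mapHom (τ : A →⋆ₐ[ℂ] B) (hτ : ∀ a, ‖τ a‖ = ‖a‖) : EllOne G A →⋆ₐ[ℂ] EllOne G B where
  toFun f := mk (fun x => τ (f x)) (by simpa only [hτ] using f.summable_norm)
  map_one' := by
    ext x
    by_cases hx : x = 1
    · subst hx; simp [one_apply_one]
    · simp [one_apply_ne hx]
  map_zero' := by ext x; simp
  map_add' f g := by ext x; simp
  map_mul' f g := by
    ext x
    have hc : Continuous τ := (AddMonoidHomClass.isometry_of_norm τ hτ).continuous
    simp only [mk_apply, mul_apply]
    rw [(summable_conv f g x).map_tsum τ hc]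
    simp
  commutes' c := by
    ext x
    simp only [mk_apply, Algebra.algebraMap_eq_smul_one, smul_apply, map_smul]
    by_cases hx : x = 1
    · subst hx; simp [one_apply_one]
    · simp [one_apply_ne hx]
  map_star' f := by ext x; simp [map_star]

@[simp] theorem mapHom_apply (τ : A →⋆ₐ[ℂ] B) (hτ : ∀ a, ‖τ a‖ = ‖a‖) (f : EllOne G A) (x : G) :
    mapHom τ hτ f x = τ (f x) := rfl

theorem norm_mapHom (τ : A →⋆ₐ[ℂ] B) (hτ : ∀ a, ‖τ a‖ = ‖a‖) (f : EllOne G A) :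
    ‖mapHom τ hτ f‖ = ‖f‖ := by
  simp [norm_eq_tsum, hτ]

end MapHom

end EllOne

/-! ### Square roots near the unit of a Banach `*`-algebra -/

/-- Squaring has the invertible derivative `x ↦ 2x` at 1, so the inverse function theorem supplies a
local square root. For self-adjoint `b` the adjoint of this root is another root near 1, and local
uniqueness forces the two to agree. -/
theorem eventually_exists_isSelfAdjoint_sq {B : Type*} [NormedRing B] [NormedAlgebra ℂ B]
    [CompleteSpace B] [StarRing B] [ContinuousStar B] :
    ∀ᶠ b in nhds (1 : B), IsSelfAdjoint b → ∃ d : B, IsUnit d ∧ IsSelfAdjoint d ∧ d * d = b := by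
  let e : B ≃L[ℂ] B := ContinuousLinearEquiv.smulLeft (Units.mk0 (2 : ℂ) two_ne_zero)
  have hd : HasStrictFDerivAt (𝕜 := ℂ) (fun x : B => x * x) (e : B →L[ℂ] B) 1 := by
    have h := (hasStrictFDerivAt_id (𝕜 := ℂ) (1 : B)).mul' (hasStrictFDerivAt_id (1 : B))
    have he : (e : B →L[ℂ] B) = (id (1 : B) • ContinuousLinearMap.id ℂ B
        + MulOpposite.op (id (1 : B)) • ContinuousLinearMap.id ℂ B) := by
      ext x
      simp [e, two_smul, Units.smul_def]
    rw [he]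
    exact h
  set g := hd.localInverse _ e 1 with hg
  have hone : (fun x : B => x * x) 1 = 1 := one_mul 1
  have hright : ∀ᶠ b in nhds (1 : B), g b * g b = b := by
    simpa using hd.eventually_right_inverse
  have hleft : ∀ᶠ x in nhds (1 : B), g (x * x) = x := hd.eventually_left_inverse
  have hgc : Filter.Tendsto g (nhds 1) (nhds 1) := by
    simpa using hd.localInverse_tendsto
  have hgs : Filter.Tendsto (fun b => star (g b)) (nhds 1) (nhds 1) := by
    simpa using hgc.star
  filter_upwards [hright, hgs.eventually hleft, hgc.eventually (Units.isOpen.mem_nhds isUnit_one)]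
    with b h1 h2 h3 hb
  refine ⟨g b, h3, ?_, h1⟩
  rw [← star_mul, h1, hb.star_eq] at h2
  exact h2.symm

/-! ### Reiter's property of amenable groups -/

section Reiter

variable {G : Type*} [Group G]

/-- Invariant means have no strictly positive coboundaries. -/
theorem IsAmenableGroup.not_forall_le_sum (h : IsAmenableGroup G) (E : Finset G)
    (f : G → G → ℝ) (C : ℝ) (hf : ∀ a x, |f a x| ≤ C) {c : ℝ} (hc : 0 < c) :
    ¬ ∀ x, c ≤ ∑ a ∈ E, (f a (a * x) - f a x) := by
  intro hcx
  obtain ⟨m, h1, hpos, hinv⟩ := h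
  let F : G → EllInfty G := fun a => ⟨fun x => (f a x : ℂ), memℓp_infty ⟨C, by
    rintro _ ⟨y, rfl⟩
    simpa using hf a y⟩⟩
  let Φ : EllInfty G := ∑ a ∈ E, (leftTranslate a⁻¹ (F a) - F a)
  have hΦ : ∀ x, Φ x = ((∑ a ∈ E, (f a (a * x) - f a x) : ℝ) : ℂ) := by
    intro x
    simp only [Φ, lp.coeFn_sum, Finset.sum_apply, lp.coeFn_sub, Pi.sub_apply, Complex.ofReal_sum,
      Complex.ofReal_sub]
    refine Finset.sum_congr rfl fun a _ => ?_
    change (f a (a⁻¹⁻¹ * x) : ℂ) - (f a x : ℂ) = _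
    rw [inv_inv]
  -- Invariance kills each coboundary; positivity of `m` on `Φ - c` would then give `-c ≥ 0`.
  have hm0 : m Φ = 0 := by simp [Φ, hinv]
  have hone : ∀ x, (1 : EllInfty G) x = 1 := fun x => by simp [lp.infty_coeFn_one]
  have hval : ∀ x, (Φ - (c : ℂ) • (1 : EllInfty G)) x
      = ((∑ a ∈ E, (f a (a * x) - f a x) - c : ℝ) : ℂ) := by
    intro x
    have : (Φ - (c : ℂ) • (1 : EllInfty G)) x = Φ x - c * (1 : EllInfty G) x := rfl
    rw [this, hΦ, hone]
    push_cast
    ring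
  have := (hpos (Φ - (c : ℂ) • (1 : EllInfty G)) fun x => by
    rw [hval, Complex.ofReal_re, Complex.ofReal_im]
    exact ⟨sub_nonneg.2 (hcx x), rfl⟩).1
  rw [map_sub, hm0, map_smul, h1] at this
  simp at this
  linarith

/-- Reiter's property: there are almost invariant finitely supported probability densities. -/
theorem IsAmenableGroup.exists_almost_invariant (h : IsAmenableGroup G) (E : Finset G) {η : ℝ}
    (hη : 0 < η) : ∃ p : G →₀ ℝ, (∀ x, 0 ≤ p x) ∧ p.sum (fun _ r => r) = 1 ∧
      ∀ a ∈ E, ∀ s : Finset G, ∑ x ∈ s, |p (a⁻¹ * x) - p x| < η := by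
  classical
  let δ : G → lp (fun _ : G => ℝ) 1 := fun x => lp.single 1 x 1
  have hδ : ∀ x, ‖δ x‖ = 1 := fun x => by simp [δ, lp.norm_single]
  let Δ : (G →₀ ℝ) →ₗ[ℝ] E → lp (fun _ : G => ℝ) 1 :=
    LinearMap.pi fun a => Finsupp.linearCombination ℝ fun x => δ (a * x) - δ x
  have hΔ : ∀ p a y, Δ p a y = p ((a : G)⁻¹ * y) - p y := by
    intro p a y
    have h1 : Δ p a = ∑ x ∈ p.support, p x • (δ (a * x) - δ x) := rfl
    rw [h1, lp.coeFn_sum, Finset.sum_apply]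
    have h2 : ∀ x, (p x • (δ (a * x) - δ x) : lp (fun _ : G => ℝ) 1) y
        = (if x = (a : G)⁻¹ * y then p x else 0) - if x = y then p x else 0 := by
      intro x
      rw [lp.coeFn_smul, Pi.smul_apply, lp.coeFn_sub, Pi.sub_apply, smul_sub]
      simp only [δ, lp.single_apply, Pi.single_apply, smul_eq_mul, mul_ite, mul_one, mul_zero,
        eq_inv_mul_iff_mul_eq, eq_comm (a := y)]
    simp only [h2, Finset.sum_sub_distrib, Finset.sum_ite_eq', Finsupp.mem_support_iff, ne_eq,
      ite_not]
    congr 1 <;> split_ifs with h <;> simp [h]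
  let P : Set (G →₀ ℝ) := {p | (∀ x, 0 ≤ p x) ∧ p.sum (fun _ r => r) = 1}
  have hP : Convex ℝ P := by
    rintro p ⟨hp0, hp1⟩ q ⟨hq0, hq1⟩ a b ha hb hab
    refine ⟨fun x => ?_, ?_⟩
    · simpa using add_nonneg (mul_nonneg ha (hp0 x)) (mul_nonneg hb (hq0 x))
    · rw [Finsupp.sum_add_index' (by simp) (by simp), Finsupp.sum_smul_index (by simp),
        Finsupp.sum_smul_index (by simp), ← Finsupp.mul_sum, ← Finsupp.mul_sum, hp1, hq1]
      simpa using hab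
  -- If 0 were not in this closed convex set, Hahn–Banach would separate it strictly. The components
  -- of the separating functional are bounded functions on `G`, and testing on point masses exhibits
  -- a coboundary that is everywhere at least `u > 0`.
  have hmem : (0 : E → lp (fun _ : G => ℝ) 1) ∈ closure (Δ '' P) := by
    by_contra hn
    obtain ⟨f, u, h0, hu⟩ :=
      geometric_hahn_banach_point_closed (hP.linear_image Δ).closure isClosed_closure hn
    rw [map_zero] at h0
    let φ : G → G → ℝ := fun a x => if ha : a ∈ E then f (Pi.single ⟨a, ha⟩ (δ x)) else 0
    refine h.not_forall_le_sum E φ ‖f‖ (fun a x => ?_) h0 fun x => ?_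
    · by_cases ha : a ∈ E
      · simp only [φ, ha, dif_pos]
        refine (f.le_opNorm _).trans ?_
        rw [Pi.norm_single, hδ, mul_one]
      · simp [φ, ha]
    · have h1 : (Finsupp.single x (1 : ℝ)) ∈ P := by
        refine ⟨fun y => ?_, by simp⟩
        rw [Finsupp.single_apply]
        split_ifs <;> norm_num
      have h2 := hu _ (subset_closure ⟨_, h1, rfl⟩)
      have h3 : Δ (Finsupp.single x 1) = ∑ a : E, Pi.single a (δ (a * x) - δ x) := by
        rw [Finset.univ_sum_single]
        ext1 a
        simp [Δ]
      rw [h3, map_sum] at h2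
      refine h2.le.trans_eq ?_
      rw [← Finset.sum_coe_sort E]
      refine Finset.sum_congr rfl fun a _ => ?_
      simp only [φ, a.2, dif_pos, Pi.single_sub, map_sub]
  obtain ⟨_, ⟨p, hp, rfl⟩, hpη⟩ := Metric.mem_closure_iff.1 hmem η hη
  rw [dist_zero_left] at hpη
  refine ⟨p, hp.1, hp.2, fun a ha s => ?_⟩
  have h1 := lp.sum_rpow_le_norm_rpow (p := 1) (by norm_num) (Δ p ⟨a, ha⟩) s
  simp only [hΔ, ENNReal.toReal_one, Real.rpow_one, Real.norm_eq_abs] at h1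
  exact (h1.trans (norm_le_pi_norm (Δ p) ⟨a, ha⟩)).trans_lt hpη

/-- Turns `ℓ¹`-almost invariance of a density into `ℓ²`-almost invariance of its square root. -/
theorem sq_sqrt_sub_sqrt_le {u v : ℝ} (hu : 0 ≤ u) (hv : 0 ≤ v) :
    (√u - √v) ^ 2 ≤ |u - v| := by
  have h1 : u - v = (√u - √v) * (√u + √v) := by
    nlinarith [Real.sq_sqrt hu, Real.sq_sqrt hv]
  rw [h1, abs_mul, ← sq_abs, sq]
  refine mul_le_mul_of_nonneg_left ?_ (abs_nonneg _)
  rw [abs_of_nonneg (add_nonneg (Real.sqrt_nonneg u) (Real.sqrt_nonneg v)), abs_le]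
  constructor <;> linarith [Real.sqrt_nonneg u, Real.sqrt_nonneg v]

open Classical in
/-- The coefficient `a ↦ ⟨L_a ξ, ξ⟩` of the left regular representation given by a real function
`ξ` supported in the finite set `s`. -/
def regularCoeff (s : Finset G) (ξ : G → ℝ) (a : G) : ℝ :=
  ∑ x ∈ s, ∑ y ∈ s, if x * y⁻¹ = a then ξ x * ξ y else 0

/-- The trivial character of an amenable group is a pointwise limit of finitely supported
coefficients of the regular representation. -/
theorem IsAmenableGroup.exists_regularCoeff (h : IsAmenableGroup G) (E : Finset G) {η : ℝ}
    (hη : 0 < η) : ∃ (s : Finset G) (ξ : G → ℝ), regularCoeff s ξ 1 = 1 ∧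
      (∀ a, 0 ≤ regularCoeff s ξ a ∧ regularCoeff s ξ a ≤ 1) ∧
      ∀ a ∈ E, 1 - regularCoeff s ξ a ≤ η := by
  classical
  obtain ⟨p, hp0, hp1, hp⟩ := h.exists_almost_invariant E hη
  let ξ : G → ℝ := fun x => √(p x)
  have hξ : ∀ x ∉ p.support, ξ x = 0 := fun x hx => by simp [ξ, Finsupp.notMem_support_iff.1 hx]
  have hξ2 : ∀ x, ξ x ^ 2 = p x := fun x => Real.sq_sqrt (hp0 x)
  have hφ : ∀ a, regularCoeff p.support ξ a = ∑ x ∈ p.support, ξ x * ξ (a⁻¹ * x) := by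
    intro a
    refine Finset.sum_congr rfl fun x _ => ?_
    have : ∀ y, x * y⁻¹ = a ↔ y = a⁻¹ * x := fun y => by
      rw [mul_inv_eq_iff_eq_mul, eq_inv_mul_iff_mul_eq, eq_comm]
    simp only [this, Finset.sum_ite_eq']
    split_ifs with hx
    · rfl
    · rw [hξ _ hx, mul_zero]
  -- For the unit vector `ξ = √p` this is the polarization `‖L_a ξ - ξ‖² = 2 - 2⟨L_a ξ, ξ⟩`; it
  -- yields both the bound by 1 and the closeness to 1.
  have hkey : ∀ a, ∃ t : Finset G,
      2 * (1 - regularCoeff p.support ξ a) = ∑ x ∈ t, (ξ (a⁻¹ * x) - ξ x) ^ 2 := by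
    intro a
    -- Contains the supports of `p` and of its translate, so both have total mass 1 on it.
    let t := p.support ∪ p.support.image (a * ·)
    have h1 : ∑ x ∈ t, p x = 1 := by
      rw [← hp1]
      exact (Finset.sum_subset Finset.subset_union_left fun x _ hx => by
        simpa using hx).symm
    have h2 : ∑ x ∈ t, p (a⁻¹ * x) = 1 := by
      rw [← hp1]
      have : ∑ x ∈ p.support.image (a * ·), p (a⁻¹ * x) = ∑ x ∈ t, p (a⁻¹ * x) :=
        Finset.sum_subset Finset.subset_union_right fun x _ hx => by
          by_contra hne
          exact hx (Finset.mem_image.2 ⟨a⁻¹ * x, Finsupp.mem_support_iff.2 hne, by simp⟩)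
      rw [← this, Finset.sum_image fun x _ y _ hxy => mul_left_cancel hxy]
      simp [Finsupp.sum]
    have h3 : regularCoeff p.support ξ a = ∑ x ∈ t, ξ x * ξ (a⁻¹ * x) := by
      rw [hφ]
      exact Finset.sum_subset Finset.subset_union_left fun x _ hx => by rw [hξ x hx, zero_mul]
    refine ⟨t, ?_⟩
    have h4 : ∀ x, (ξ (a⁻¹ * x) - ξ x) ^ 2
        = p (a⁻¹ * x) + p x - 2 * (ξ x * ξ (a⁻¹ * x)) := fun x => by
      rw [← hξ2, ← hξ2]; ring
    simp only [h4, Finset.sum_sub_distrib, Finset.sum_add_distrib, h1, h2, h3, ← Finset.mul_sum]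
    ring
  refine ⟨p.support, ξ, ?_, fun a => ⟨?_, ?_⟩, fun a ha => ?_⟩
  · rw [hφ, ← hp1]
    exact Finset.sum_congr rfl fun x _ => by rw [inv_one, one_mul, ← sq, hξ2]
  · exact Finset.sum_nonneg fun x _ => Finset.sum_nonneg fun y _ => by
      split_ifs
      exacts [mul_nonneg (Real.sqrt_nonneg _) (Real.sqrt_nonneg _), le_rfl]
  · obtain ⟨t, ht⟩ := hkey a
    have : 0 ≤ ∑ x ∈ t, (ξ (a⁻¹ * x) - ξ x) ^ 2 := Finset.sum_nonneg fun x _ => sq_nonneg _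
    linarith
  · obtain ⟨t, ht⟩ := hkey a
    have h1 : ∑ x ∈ t, (ξ (a⁻¹ * x) - ξ x) ^ 2 ≤ ∑ x ∈ t, |p (a⁻¹ * x) - p x| :=
      Finset.sum_le_sum fun x _ => sq_sqrt_sub_sqrt_le (hp0 _) (hp0 _)
    linarith [hp a ha t]

end Reiter

/-! ### Weighted composition operators between `ℓ²`-spaces -/

section WeightedComp

variable {X Y : Type*}

theorem EllTwo.hasSum_norm_sq (v : EllTwo X) : HasSum (fun x => ‖v x‖ ^ 2) (‖v‖ ^ 2) := by
  simpa using lp.hasSum_norm (p := 2) (by norm_num) v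

theorem memlp_two_iff {f : X → ℂ} :
    Memℓp (E := fun _ : X => ℂ) f 2 ↔ Summable fun x => ‖f x‖ ^ 2 := by
  simpa using memℓp_gen_iff (E := fun _ : X => ℂ) (p := 2) (f := f) (by norm_num)

theorem EllTwo.norm_le_of_tsum_sq_le {v : EllTwo X} {C : ℝ} (hC : 0 ≤ C)
    (h : ∑' x, ‖v x‖ ^ 2 ≤ C ^ 2) : ‖v‖ ≤ C := by
  rw [(EllTwo.hasSum_norm_sq v).tsum_eq] at h
  exact le_of_sq_le_sq h hC

theorem EllInfty.norm_apply_le (w : EllInfty X) (x : X) : ‖w x‖ ≤ ‖w‖ :=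
  lp.norm_apply_le_norm ENNReal.top_ne_zero w x

theorem summable_weightedComp {s : X → Y} (hs : Function.Injective s) (w : EllInfty X)
    (v : EllTwo Y) : Summable fun x => ‖w x * v (s x)‖ ^ 2 := by
  refine (((EllTwo.hasSum_norm_sq v).summable.comp_injective hs).mul_left
    (‖w‖ ^ 2)).of_nonneg_of_le (fun x => sq_nonneg _) fun x => ?_
  rw [norm_mul, mul_pow]
  exact mul_le_mul_of_nonneg_right (pow_le_pow_left₀ (norm_nonneg _) (EllInfty.norm_apply_le w x) 2)
    (sq_nonneg _)

/-- The operator `(M v)(x) = w(x) v(s(x))` for an injective map `s` and a bounded weight `w`. -/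
def weightedComp (s : X → Y) (hs : Function.Injective s) (w : EllInfty X) :
    EllTwo Y →L[ℂ] EllTwo X :=
  LinearMap.mkContinuous
    { toFun v := ⟨fun x => w x * v (s x), memlp_two_iff.2 (summable_weightedComp hs w v)⟩
      map_add' u v := by
        refine lp.ext (funext fun x => ?_)
        exact mul_add _ _ _
      map_smul' c v := by
        refine lp.ext (funext fun x => ?_)
        exact mul_left_comm _ _ _ }
    ‖w‖ fun v => by
      refine EllTwo.norm_le_of_tsum_sq_le (by positivity) ?_
      have h := (EllTwo.hasSum_norm_sq v)
      calc ∑' x, ‖w x * v (s x)‖ ^ 2 ≤ ∑' x, ‖w‖ ^ 2 * ‖v (s x)‖ ^ 2 := by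
            refine (summable_weightedComp hs w v).tsum_le_tsum (fun x => ?_)
              ((h.summable.comp_injective hs).mul_left _)
            rw [norm_mul, mul_pow]
            exact mul_le_mul_of_nonneg_right
              (pow_le_pow_left₀ (norm_nonneg _) (EllInfty.norm_apply_le w x) 2) (sq_nonneg _)
        _ = ‖w‖ ^ 2 * ∑' x, ‖v (s x)‖ ^ 2 := tsum_mul_left
        _ ≤ ‖w‖ ^ 2 * ‖v‖ ^ 2 := by
            refine mul_le_mul_of_nonneg_left ?_ (sq_nonneg _)
            rw [← h.tsum_eq]
            exact tsum_comp_le_tsum_of_inj h.summable (fun _ => sq_nonneg _) hs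
        _ = (‖w‖ * ‖v‖) ^ 2 := (mul_pow _ _ _).symm

theorem norm_weightedComp_le (s : X → Y) (hs : Function.Injective s) (w : EllInfty X) :
    ‖weightedComp s hs w‖ ≤ ‖w‖ :=
  LinearMap.mkContinuous_norm_le _ (norm_nonneg _) _

end WeightedComp

/-! ### Twisted shifts -/

section TwistedShift

variable {G : Type*} [Group G] {ω : G → G → EllInfty G}

@[simp] theorem leftTranslate_apply (x : G) (φ : EllInfty G) (y : G) :
    leftTranslate x φ y = φ (x⁻¹ * y) := rfl

theorem EllInfty.mul_apply (φ ψ : EllInfty G) (x : G) : (φ * ψ) x = φ x * ψ x := rfl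

theorem EllInfty.one_apply (x : G) : (1 : EllInfty G) x = 1 := rfl

theorem IsTwoCocycle.norm_apply (hω : IsTwoCocycle ω) (x y z : G) : ‖ω x y z‖ = 1 := by
  have h : (star (ω x y) * ω x y) z = 1 := by
    rw [(Unitary.mem_iff.1 (hω.mem_unitary x y)).1]
    rfl
  rw [EllInfty.mul_apply, lp.star_apply] at h
  have h' := congrArg norm h
  rw [norm_mul, norm_star, norm_one, ← sq] at h'
  exact (pow_eq_one_iff_of_nonneg (norm_nonneg _) two_ne_zero).1 h'

theorem IsTwoCocycle.norm_twistPhase (hω : IsTwoCocycle ω) (x y : G) : ‖twistPhase ω x y‖ = 1 :=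
  hω.norm_apply _ _ _

theorem IsTwoCocycle.twistPhase_self (hω : IsTwoCocycle ω) (x : G) : twistPhase ω x x = 1 := by
  rw [twistPhase, mul_inv_cancel, hω.map_one_right, EllInfty.one_apply]

/-- The cocycle identity at `(x⁻¹, xy⁻¹, yz⁻¹)`, evaluated at the identity. It makes a product of
twisted shifts a twisted shift, with the cocycle appearing in the coefficient. -/
theorem IsTwoCocycle.twistPhase_mul (hω : IsTwoCocycle ω) (x y z : G) :
    twistPhase ω x y * twistPhase ω y z = ω (x * y⁻¹) (y * z⁻¹) x * twistPhase ω x z := by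
  have h := congrArg (fun φ : EllInfty G => φ 1) (hω.cocycle x⁻¹ (x * y⁻¹) (y * z⁻¹))
  simpa [EllInfty.mul_apply, twistPhase, mul_assoc] using h

/-- The case `z = x` of `twistPhase_mul`, where the right-hand phase is 1; the phases are
unimodular, so inverses are conjugates. -/
theorem IsTwoCocycle.star_twistPhase (hω : IsTwoCocycle ω) (x y : G) :
    star (twistPhase ω y x) = star (ω (x * y⁻¹) (y * x⁻¹) x) * twistPhase ω x y := by
  have h := hω.twistPhase_mul x y x
  rw [hω.twistPhase_self, mul_one] at h
  have h1 : star (twistPhase ω y x) * twistPhase ω y x = 1 := by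
    rw [Complex.star_def, ← Complex.normSq_eq_conj_mul_self, Complex.normSq_eq_norm_sq,
      hω.norm_twistPhase]
    simp
  have h2 : star (twistPhase ω x y) * twistPhase ω x y = 1 := by
    rw [Complex.star_def, ← Complex.normSq_eq_conj_mul_self, Complex.normSq_eq_norm_sq,
      hω.norm_twistPhase]
    simp
  rw [← h, star_mul']
  linear_combination (-star (twistPhase ω y x)) * h2

/-- The phases `x ↦ λ(x, a⁻¹ x)` on the `a`-th diagonal. -/
def IsTwoCocycle.phase (hω : IsTwoCocycle ω) (a : G) : EllInfty G :=
  ⟨fun x => twistPhase ω x (a⁻¹ * x), memℓp_infty ⟨1, by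
    rintro _ ⟨x, rfl⟩
    exact (hω.norm_twistPhase _ _).le⟩⟩

@[simp] theorem IsTwoCocycle.phase_apply (hω : IsTwoCocycle ω) (a x : G) :
    hω.phase a x = twistPhase ω x (a⁻¹ * x) := rfl

/-- The weighted shift `(M v)(x) = ψ(x) v(a⁻¹ x)`. -/
def shiftOp (a : G) (ψ : EllInfty G) : EllTwo G →L[ℂ] EllTwo G :=
  weightedComp (a⁻¹ * ·) (mul_right_injective a⁻¹) ψ

@[simp] theorem shiftOp_apply (a : G) (ψ : EllInfty G) (v : EllTwo G) (x : G) :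
    shiftOp a ψ v x = ψ x * v (a⁻¹ * x) := rfl

/-- The operator `(M v)(x) = φ(a⁻¹ x) λ(x, a⁻¹ x) v(a⁻¹ x)`, that is the twisted integral operator
whose kernel lives on the `a`-th diagonal and equals `φ` there. -/
def IsTwoCocycle.twistedShift (hω : IsTwoCocycle ω) (a : G) :
    EllInfty G →ₗᵢ[ℂ] EllTwo G →L[ℂ] EllTwo G where
  toFun φ := shiftOp a (leftTranslate a φ * hω.phase a)
  map_add' φ ψ := by
    ext v x
    change (φ (a⁻¹ * x) + ψ (a⁻¹ * x)) * twistPhase ω x (a⁻¹ * x) * v (a⁻¹ * x)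
      = φ (a⁻¹ * x) * twistPhase ω x (a⁻¹ * x) * v (a⁻¹ * x)
        + ψ (a⁻¹ * x) * twistPhase ω x (a⁻¹ * x) * v (a⁻¹ * x)
    ring
  map_smul' c φ := by
    ext v x
    change (c * φ (a⁻¹ * x)) * twistPhase ω x (a⁻¹ * x) * v (a⁻¹ * x)
      = c * (φ (a⁻¹ * x) * twistPhase ω x (a⁻¹ * x) * v (a⁻¹ * x))
    ring
  norm_map' φ := by
    classical
    refine le_antisymm ((norm_weightedComp_le (a⁻¹ * ·) (mul_right_injective a⁻¹)
      (leftTranslate a φ * hω.phase a)).trans ?_) ?_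
    · refine lp.norm_le_of_forall_le (norm_nonneg _) fun x => ?_
      rw [EllInfty.mul_apply, leftTranslate_apply, hω.phase_apply, norm_mul, hω.norm_twistPhase,
        mul_one]
      exact EllInfty.norm_apply_le φ _
    · refine lp.norm_le_of_forall_le (norm_nonneg _) fun y => ?_
      -- The basis vector at `y` is moved to `a * y` and multiplied by `φ y` times a phase, which
      -- gives the lower bound for the norm.
      let e : EllTwo G := lp.single 2 y 1
      have he : ‖e‖ = 1 := by simp [e, lp.norm_single]
      have h1 : ‖shiftOp a (leftTranslate a φ * hω.phase a) e (a * y)‖ = ‖φ y‖ := by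
        rw [shiftOp_apply, EllInfty.mul_apply, leftTranslate_apply, hω.phase_apply,
          inv_mul_cancel_left, norm_mul, norm_mul, hω.norm_twistPhase, mul_one]
        simp [e]
      rw [← h1]
      calc _ ≤ ‖shiftOp a (leftTranslate a φ * hω.phase a) e‖ :=
            lp.norm_apply_le_norm two_ne_zero _ _
        _ ≤ _ := by simpa [he] using
            (shiftOp a (leftTranslate a φ * hω.phase a)).le_opNorm e

theorem IsTwoCocycle.twistedShift_eq (hω : IsTwoCocycle ω) (a : G) (φ : EllInfty G) :
    hω.twistedShift a φ = shiftOp a (leftTranslate a φ * hω.phase a) := rfl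

theorem IsTwoCocycle.twistedShift_apply (hω : IsTwoCocycle ω) (a : G) (φ : EllInfty G)
    (v : EllTwo G) (x : G) : hω.twistedShift a φ v x
      = φ (a⁻¹ * x) * twistPhase ω x (a⁻¹ * x) * v (a⁻¹ * x) := rfl

theorem IsTwoCocycle.twistedShift_one (hω : IsTwoCocycle ω) : hω.twistedShift 1 1 = 1 := by
  ext v x
  simp [hω.twistedShift_apply, hω.twistPhase_self]

theorem IsTwoCocycle.twistedShift_mul (hω : IsTwoCocycle ω) (a b : G) (φ ψ : EllInfty G) :
    hω.twistedShift a φ * hω.twistedShift b ψ = hω.twistedShift (a * b)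
      (leftTranslate b⁻¹ φ * ψ * leftTranslate (a * b)⁻¹ (ω a b)) := by
  ext v x
  have h := hω.twistPhase_mul x (a⁻¹ * x) ((a * b)⁻¹ * x)
  have h1 : x * (a⁻¹ * x)⁻¹ = a := by group
  have h2 : a⁻¹ * x * ((a * b)⁻¹ * x)⁻¹ = b := by group
  have h3 : b⁻¹ * (a⁻¹ * x) = (a * b)⁻¹ * x := by group
  have h4 : b⁻¹⁻¹ * ((a * b)⁻¹ * x) = a⁻¹ * x := by group
  have h5 : ((a * b)⁻¹)⁻¹ * ((a * b)⁻¹ * x) = x := by group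
  rw [h1, h2] at h
  change hω.twistedShift a φ (hω.twistedShift b ψ v) x = _
  rw [hω.twistedShift_apply, hω.twistedShift_apply,
    hω.twistedShift_apply, EllInfty.mul_apply, EllInfty.mul_apply, leftTranslate_apply,
    leftTranslate_apply, h3, h4, h5]
  linear_combination φ (a⁻¹ * x) * ψ ((a * b)⁻¹ * x) * v ((a * b)⁻¹ * x) * h

theorem star_shiftOp (a : G) (ψ : EllInfty G) :
    star (shiftOp a ψ) = shiftOp a⁻¹ (leftTranslate a⁻¹ (star ψ)) := by
  rw [ContinuousLinearMap.star_eq_adjoint, eq_comm, ContinuousLinearMap.eq_adjoint_iff]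
  intro u v
  rw [lp.inner_eq_tsum, lp.inner_eq_tsum, ← (Equiv.mulLeft a⁻¹).tsum_eq]
  refine tsum_congr fun x => ?_
  simp only [Equiv.coe_mulLeft, shiftOp_apply, leftTranslate_apply, lp.star_apply, inv_inv,
    mul_inv_cancel_left, RCLike.inner_apply, map_mul, Complex.star_def, Complex.conj_conj]
  ring

theorem IsTwoCocycle.star_twistedShift (hω : IsTwoCocycle ω) (a : G) (φ : EllInfty G) :
    star (hω.twistedShift a φ)
      = hω.twistedShift a⁻¹ (leftTranslate a (star (φ * ω a⁻¹ a))) := by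
  rw [hω.twistedShift_eq, star_shiftOp, hω.twistedShift_eq]
  congr 1
  refine lp.ext (funext fun x => ?_)
  have h := hω.star_twistPhase x (a * x)
  have h1 : x * (a * x)⁻¹ = a⁻¹ := by group
  have h2 : a * x * x⁻¹ = a := by group
  rw [h1, h2] at h
  simp only [leftTranslate_apply, lp.star_apply, EllInfty.mul_apply, hω.phase_apply, inv_inv,
    inv_mul_cancel_left, star_mul']
  rw [h]
  ring

end TwistedShift

/-! ### The twisted integral operators as the image of a closed subalgebra of `ℓ¹(G; 𝔹(ℓ²(G)))` -/

section TwistedAlgebra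

variable {G : Type*} [Group G] {ω : G → G → EllInfty G} (A : StarSubalgebra ℂ (EllInfty G))

/-- The twisted shifts along the `a`-th diagonal with coefficient functions in `A`. -/
def twistedFiber (hω : IsTwoCocycle ω) (a : G) : Submodule ℂ (EllTwo G →L[ℂ] EllTwo G) :=
  (Subalgebra.toSubmodule A.toSubalgebra).map (hω.twistedShift a).toLinearMap

variable {A}

theorem mem_twistedFiber {hω : IsTwoCocycle ω} {a : G} {T : EllTwo G →L[ℂ] EllTwo G} :
    T ∈ twistedFiber A hω a ↔ ∃ φ ∈ A, hω.twistedShift a φ = T := Iff.rfl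

theorem isClosed_twistedFiber (hA : IsClosed (A : Set (EllInfty G))) (hω : IsTwoCocycle ω) (a : G) :
    IsClosed (twistedFiber A hω a : Set (EllTwo G →L[ℂ] EllTwo G)) :=
  (hω.twistedShift a).isometry.isClosedEmbedding.isClosedMap _ hA

theorem mem_of_hasSum {ι E : Type*} [NormedAddCommGroup E] [NormedSpace ℂ E] {M : Submodule ℂ E}
    (hM : IsClosed (M : Set E)) {f : ι → E} {x : E} (hf : ∀ i, f i ∈ M) (h : HasSum f x) : x ∈ M :=
  hM.mem_of_tendsto h (Filter.Eventually.of_forall fun _ => Submodule.sum_mem _ fun i _ => hf i)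

variable (A)

/-- The closed `*`-subalgebra of `ℓ¹(G; 𝔹(ℓ²(G)))` of all functions whose value at `a` is a twisted
shift along the `a`-th diagonal with coefficient function in `A`. -/
def twistedAlgebra (hA : IsClosed (A : Set (EllInfty G)))
    (hAtrans : ∀ (x : G), ∀ φ ∈ A, leftTranslate x φ ∈ A)
    (hω : IsTwoCocycle ω) (hωA : ∀ x y, ω x y ∈ A) :
    StarSubalgebra ℂ (EllOne G (EllTwo G →L[ℂ] EllTwo G)) where
  carrier := {f | ∀ a, f a ∈ twistedFiber A hω a}
  mul_mem' {f g} hf hg a := by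
    rw [EllOne.mul_apply]
    refine mem_of_hasSum (isClosed_twistedFiber hA hω a) (fun y => ?_)
      (EllOne.summable_conv f g a).hasSum
    obtain ⟨φ, hφ, h1⟩ := mem_twistedFiber.1 (hf y)
    obtain ⟨ψ, hψ, h2⟩ := mem_twistedFiber.1 (hg (y⁻¹ * a))
    refine mem_twistedFiber.2 ⟨_, mul_mem (mul_mem (hAtrans (y⁻¹ * a)⁻¹ _ hφ) hψ)
      (hAtrans (y * (y⁻¹ * a))⁻¹ _ (hωA y (y⁻¹ * a))), ?_⟩
    rw [← h1, ← h2]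
    refine Eq.trans ?_ (hω.twistedShift_mul y (y⁻¹ * a) φ ψ).symm
    rw [mul_inv_cancel_left]
  add_mem' {f g} hf hg a := add_mem (hf a) (hg a)
  algebraMap_mem' c a := by
    rw [Algebra.algebraMap_eq_smul_one, EllOne.smul_apply]
    refine Submodule.smul_mem _ _ ?_
    by_cases ha : a = 1
    · subst ha
      rw [EllOne.one_apply_one]
      exact ⟨1, one_mem A, hω.twistedShift_one⟩
    · rw [EllOne.one_apply_ne ha]
      exact Submodule.zero_mem _
  star_mem' {f} hf a := by
    obtain ⟨φ, hφ, h1⟩ := mem_twistedFiber.1 (hf a⁻¹)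
    refine mem_twistedFiber.2 ⟨_, hAtrans a⁻¹ _ (star_mem (mul_mem hφ (hωA a⁻¹⁻¹ a⁻¹))), ?_⟩
    rw [EllOne.star_apply, ← h1]
    refine Eq.trans ?_ (hω.star_twistedShift a⁻¹ φ).symm
    rw [inv_inv]

variable {A}

theorem mem_twistedAlgebra {hA : IsClosed (A : Set (EllInfty G))}
    {hAtrans : ∀ (x : G), ∀ φ ∈ A, leftTranslate x φ ∈ A}
    {hω : IsTwoCocycle ω} {hωA : ∀ x y, ω x y ∈ A} {f : EllOne G (EllTwo G →L[ℂ] EllTwo G)} :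
    f ∈ twistedAlgebra A hA hAtrans hω hωA ↔ ∀ a, f a ∈ twistedFiber A hω a := Iff.rfl

theorem isClosed_twistedAlgebra (hA : IsClosed (A : Set (EllInfty G)))
    (hAtrans : ∀ (x : G), ∀ φ ∈ A, leftTranslate x φ ∈ A)
    (hω : IsTwoCocycle ω) (hωA : ∀ x y, ω x y ∈ A) :
    IsClosed (twistedAlgebra A hA hAtrans hω hωA :
      Set (EllOne G (EllTwo G →L[ℂ] EllTwo G))) := by
  have : (twistedAlgebra A hA hAtrans hω hωA : Set (EllOne G (EllTwo G →L[ℂ] EllTwo G)))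
      = ⋂ a, (fun f : EllOne G (EllTwo G →L[ℂ] EllTwo G) => f a) ⁻¹' twistedFiber A hω a := by
    ext f
    simp [mem_twistedAlgebra]
  rw [this]
  exact isClosed_iInter fun a =>
    (isClosed_twistedFiber hA hω a).preimage (EllOne.continuous_apply a)

/-- The series of the values of an integral operator, along diagonals. -/
theorem isTwistedIntegralOperator_sumHom (hω : IsTwoCocycle ω)
    (f : EllOne G (EllTwo G →L[ℂ] EllTwo G)) (φ : G → EllInfty G)
    (hf : ∀ a, hω.twistedShift a (φ a) = f a) (K : G → G → ℂ) (hK : ∀ x y, K x y = φ (x * y⁻¹) y) :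
    IsTwistedIntegralOperator ω K (EllOne.sumHom f) := by
  intro v x
  have h1 : HasSum (fun a => f a v x) (EllOne.sumHom f v x) :=
    ((EllOne.hasSum_sumHom f).mapL
      ((lp.evalCLM ℂ (fun _ : G => ℂ) 2 x).comp (ContinuousLinearMap.apply ℂ (EllTwo G) v)))
  -- Substitutes `y = a⁻¹ * x`, turning the row sum into a sum over diagonals.
  rw [← ((Equiv.inv G).trans (Equiv.mulRight x)).hasSum_iff]
  convert h1 using 1
  funext a
  rw [← hf a, hω.twistedShift_apply]
  simp [hK]

theorem IsTwistedIntegralOperator.unique {K : G → G → ℂ} {S T : EllTwo G →L[ℂ] EllTwo G}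
    (hS : IsTwistedIntegralOperator ω K S) (hT : IsTwistedIntegralOperator ω K T) : S = T := by
  ext v x
  exact (hS v x).unique (hT v x)

/-- The kernel is cut into diagonals `φ_a(z) = K(az, z)`. Domination gives `‖φ_a‖ ≤ ‖k a‖`, so the
associated shifts are absolutely summable, which also provides boundedness of the operator. -/
theorem exists_mem_twistedAlgebra (hA : IsClosed (A : Set (EllInfty G)))
    (hAtrans : ∀ (x : G), ∀ φ ∈ A, leftTranslate x φ ∈ A)
    (hω : IsTwoCocycle ω) (hωA : ∀ x y, ω x y ∈ A) {K : G → G → ℂ} (hK : K ∈ twistedKernels A) :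
    ∃ f ∈ twistedAlgebra A hA hAtrans hω hωA,
      IsTwistedIntegralOperator ω K (EllOne.sumHom f) := by
  obtain ⟨⟨k, hk⟩, hφ⟩ := hK
  choose φ hφA hφ using fun a => hφ a 1
  simp only [one_mul] at hφ
  have hsum : Summable fun a => ‖hω.twistedShift a (φ a)‖ := by
    refine k.summable_norm.of_nonneg_of_le (fun _ => norm_nonneg _) fun a => ?_
    rw [LinearIsometry.norm_map]
    refine lp.norm_le_of_forall_le (norm_nonneg _) fun z => ?_
    rw [hφ]
    simpa using hk (a * z) z
  exact ⟨EllOne.mk _ hsum, fun a => ⟨φ a, hφA a, rfl⟩,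
    isTwistedIntegralOperator_sumHom hω _ φ (fun a => rfl) K fun x y => by simp [hφ]⟩

theorem mem_twistedIntegralOperators_iff (hA : IsClosed (A : Set (EllInfty G)))
    (hAtrans : ∀ (x : G), ∀ φ ∈ A, leftTranslate x φ ∈ A)
    (hω : IsTwoCocycle ω) (hωA : ∀ x y, ω x y ∈ A) {T : EllTwo G →L[ℂ] EllTwo G} :
    T ∈ twistedIntegralOperators A ω ↔
      ∃ f ∈ twistedAlgebra A hA hAtrans hω hωA, EllOne.sumHom f = T := by
  symm
  constructor
  · rintro ⟨f, hf, rfl⟩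
    choose φ hφA hφ using hf
    have hk : Summable fun a => ‖(‖f a‖ : ℂ)‖ := by simpa using f.summable_norm
    -- The kernel is read off the diagonals, with `k a = ‖f a‖` as dominating function; translation
    -- invariance of `A` puts all functions `z ↦ K(xz, yz)` in `A`.
    refine ⟨fun x y => φ (x * y⁻¹) y, ⟨⟨EllOne.mk _ hk, fun x y => ?_⟩, fun x y =>
      ⟨leftTranslate y⁻¹ (φ (x * y⁻¹)), hAtrans _ _ (hφA _), fun z => ?_⟩⟩,
      isTwistedIntegralOperator_sumHom hω f φ hφ _ fun x y => rfl⟩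
    · rw [EllOne.mk_apply, ← hφ]
      have h : ‖hω.twistedShift (x * y⁻¹) (φ (x * y⁻¹))‖ = ‖φ (x * y⁻¹)‖ :=
        LinearIsometry.norm_map _ _
      erw [h]
      simpa using EllInfty.norm_apply_le (φ (x * y⁻¹)) y
    · simp
  · rintro ⟨K, hK, hT⟩
    obtain ⟨f, hf, hfK⟩ := exists_mem_twistedAlgebra hA hAtrans hω hωA hK
    exact ⟨f, hf, hfK.unique hT⟩

end TwistedAlgebra

/-! ### Infinite inflations of operators on `ℓ²(G)` -/

section Inflation

variable {G J : Type*}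

/-- The slice `v ↦ v(·, l)`. -/
def slice (l : J) : EllTwo (G × J) →L[ℂ] EllTwo G :=
  weightedComp (fun x => (x, l)) (fun _ _ h => congrArg Prod.fst h) 1

@[simp] theorem slice_apply (l : J) (v : EllTwo (G × J)) (x : G) : slice l v x = v (x, l) :=
  one_mul (v (x, l))

theorem hasSum_norm_slice_sq (v : EllTwo (G × J)) :
    HasSum (fun l => ‖slice l v‖ ^ 2) (‖v‖ ^ 2) := by
  have h := (EllTwo.hasSum_norm_sq v)
  rw [← (Equiv.prodComm J G).hasSum_iff] at h
  exact h.prod_fiberwise fun l => by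
    simpa using EllTwo.hasSum_norm_sq (slice l v)

theorem summable_inflation (T : EllTwo G →L[ℂ] EllTwo G) (v : EllTwo (G × J)) :
    Summable fun p : G × J => ‖T (slice p.2 v) p.1‖ ^ 2 := by
  rw [← (Equiv.prodComm J G).summable_iff]
  refine (summable_prod_of_nonneg fun _ => sq_nonneg _).2 ⟨fun l => ?_, ?_⟩
  · exact (EllTwo.hasSum_norm_sq (T (slice l v))).summable
  · refine ((hasSum_norm_slice_sq v).summable.mul_left (‖T‖ ^ 2)).of_nonneg_of_le
      (fun l => tsum_nonneg fun _ => sq_nonneg _) fun l => ?_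
    refine (EllTwo.hasSum_norm_sq (T (slice l v))).tsum_eq.le.trans ?_
    rw [← mul_pow]
    exact pow_le_pow_left₀ (norm_nonneg _) (T.le_opNorm _) 2

/-- The underlying vector of `(T ⊗ 1) v`. -/
def inflationVec (T : EllTwo G →L[ℂ] EllTwo G) (v : EllTwo (G × J)) : EllTwo (G × J) :=
  ⟨fun p => T (slice p.2 v) p.1, memlp_two_iff.2 (summable_inflation T v)⟩

theorem slice_inflationVec (T : EllTwo G →L[ℂ] EllTwo G) (v : EllTwo (G × J)) (l : J) :
    slice l (inflationVec T v) = T (slice l v) := by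
  refine lp.ext (funext fun x => ?_)
  rw [slice_apply]
  rfl

theorem ext_slice {u v : EllTwo (G × J)} (h : ∀ l, slice l u = slice l v) : u = v := by
  refine lp.ext (funext fun p => ?_)
  have := congrArg (fun w : EllTwo G => w p.1) (h p.2)
  simpa using this

theorem norm_inflationVec_le (T : EllTwo G →L[ℂ] EllTwo G) (v : EllTwo (G × J)) :
    ‖inflationVec T v‖ ≤ ‖T‖ * ‖v‖ := by
  refine le_of_sq_le_sq ?_ (by positivity)
  rw [mul_pow]
  refine hasSum_le (fun l => ?_) (hasSum_norm_slice_sq (inflationVec T v))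
    ((hasSum_norm_slice_sq v).mul_left (‖T‖ ^ 2))
  rw [slice_inflationVec, ← mul_pow]
  exact pow_le_pow_left₀ (norm_nonneg _) (T.le_opNorm _) 2

theorem hasSum_inner_slice (u v : EllTwo (G × J)) :
    HasSum (fun l => inner ℂ (slice l u) (slice l v)) (inner ℂ u v) := by
  have h := lp.hasSum_inner (𝕜 := ℂ) u v
  rw [← (Equiv.prodComm J G).hasSum_iff] at h
  exact h.prod_fiberwise fun l => by
    simpa using lp.hasSum_inner (𝕜 := ℂ) (slice l u) (slice l v)

/-- The bounded operator `T ⊗ 1` on `ℓ²(G × J)`. -/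
def inflationCLM (T : EllTwo G →L[ℂ] EllTwo G) : EllTwo (G × J) →L[ℂ] EllTwo (G × J) :=
  LinearMap.mkContinuous
    { toFun := inflationVec T
      map_add' u v := ext_slice fun l => by simp [slice_inflationVec]
      map_smul' c v := ext_slice fun l => by simp [slice_inflationVec] }
    ‖T‖ (norm_inflationVec_le T)

@[simp] theorem slice_inflationCLM (T : EllTwo G →L[ℂ] EllTwo G) (v : EllTwo (G × J)) (l : J) :
    slice l (inflationCLM T v) = T (slice l v) := slice_inflationVec T v l

/-- The `*`-homomorphism `T ↦ T ⊗ 1` from `𝔹(ℓ²(G))` to `𝔹(ℓ²(G × J))`. -/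
def inflation (G J : Type*) :
    (EllTwo G →L[ℂ] EllTwo G) →⋆ₐ[ℂ] (EllTwo (G × J) →L[ℂ] EllTwo (G × J)) where
  toFun := inflationCLM
  map_one' := ContinuousLinearMap.ext fun v => ext_slice fun l => by simp
  map_zero' := ContinuousLinearMap.ext fun v => ext_slice fun l => by simp
  map_add' S T := ContinuousLinearMap.ext fun v => ext_slice fun l => by simp
  map_mul' S T := ContinuousLinearMap.ext fun v => ext_slice fun l => by simp
  commutes' c := ContinuousLinearMap.ext fun v => ext_slice fun l => by
    simp [Algebra.algebraMap_eq_smul_one]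
  map_star' T := by
    rw [ContinuousLinearMap.star_eq_adjoint, ContinuousLinearMap.star_eq_adjoint,
      ContinuousLinearMap.eq_adjoint_iff]
    intro u v
    refine (hasSum_inner_slice _ _).unique ?_
    convert hasSum_inner_slice u (inflationCLM T v) using 2 with l
    rw [slice_inflationCLM, slice_inflationCLM, ContinuousLinearMap.adjoint_inner_left]

@[simp] theorem slice_inflation (T : EllTwo G →L[ℂ] EllTwo G) (v : EllTwo (G × J)) (l : J) :
    slice l (inflation G J T v) = T (slice l v) := slice_inflationVec T v l

theorem inflation_apply (T : EllTwo G →L[ℂ] EllTwo G) (v : EllTwo (G × J)) (x : G) (l : J) :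
    inflation G J T v (x, l) = T (slice l v) x := rfl

theorem inflation_injective [Nonempty J] : Function.Injective (inflation G J) := by
  classical
  rw [injective_iff_map_eq_zero]
  intro T hT
  obtain ⟨l⟩ := ‹Nonempty J›
  have h1 : ∀ x, T (lp.single 2 x 1) = 0 := by
    intro x
    have h2 : slice l (lp.single 2 (x, l) (1 : ℂ)) = lp.single 2 x 1 := by
      refine lp.ext (funext fun y => ?_)
      simp [Pi.single_apply]
    rw [← h2, ← slice_inflation, hT]
    simp
  refine lp.ext_continuousLinearMap (by norm_num) fun x => ?_
  ext1
  simpa using h1 x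

theorem norm_inflation [Nonempty J] (T : EllTwo G →L[ℂ] EllTwo G) : ‖inflation G J T‖ = ‖T‖ :=
  NonUnitalStarAlgHom.norm_map (inflation G J) inflation_injective T

end Inflation

/-! ### Partial translations of `ℓ²(G × List G)` -/

section ConsOp

variable {G : Type*} [Group G]

/-- The map `(x, l) ↦ (x, (y⁻¹ x) :: l)`. -/
def consMap (y : G) (p : G × List G) : G × List G := (p.1, (y⁻¹ * p.1) :: p.2)

theorem consMap_injective (y : G) : Function.Injective (consMap y) := by
  rintro ⟨x, l⟩ ⟨x', l'⟩ h
  simp only [consMap, Prod.mk.injEq, List.cons.injEq] at h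
  exact Prod.ext h.1 h.2.2

/-- The co-isometry `(E v)(x, l) = v(x, (y⁻¹ x) :: l)`. -/
def consOp (y : G) : EllTwo (G × List G) →L[ℂ] EllTwo (G × List G) :=
  weightedComp (consMap y) (consMap_injective y) 1

@[simp] theorem consOp_apply (y : G) (v : EllTwo (G × List G)) (p : G × List G) :
    consOp y v p = v (consMap y p) := one_mul (v (consMap y p))

-- Found by pairing with basis vectors: the adjoint reads the head of the list as a label and keeps
-- only the matching ones.
open Classical in
theorem star_consOp_apply (y : G) (v : EllTwo (G × List G)) (x z : G) (l : List G) :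
    star (consOp y) v (x, z :: l) = if z = y⁻¹ * x then v (x, l) else 0 := by
  have h1 : star (consOp y) v (x, z :: l)
      = inner ℂ (consOp y (lp.single 2 (x, z :: l) (1 : ℂ))) v := by
    rw [← ContinuousLinearMap.adjoint_inner_right, lp.inner_single_left]
    simp [ContinuousLinearMap.star_eq_adjoint]
  rw [h1, lp.inner_eq_tsum, tsum_eq_single (x, l)]
  · rw [consOp_apply, lp.single_apply, Pi.single_apply, consMap]
    by_cases h : z = y⁻¹ * x
    · simp [h]
    · simp [h, Ne.symm h]
  · rintro ⟨x', l'⟩ hne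
    rw [consOp_apply, lp.single_apply, Pi.single_apply, consMap, if_neg]
    · simp
    · simp only [Prod.mk.injEq, List.cons.injEq, not_and]
      intro hx _ hl
      exact hne (Prod.ext hx hl)

open Classical in
/-- Conjugating the inflation of a weighted shift with partial translations selects diagonals. -/
theorem consOp_mul_inflation_shiftOp (x y a : G) (ψ : EllInfty G) :
    consOp x * inflation G (List G) (shiftOp a ψ) * star (consOp y)
      = if x * y⁻¹ = a then inflation G (List G) (shiftOp a ψ) else 0 := by
  refine ContinuousLinearMap.ext fun v => lp.ext (funext fun p => ?_)
  obtain ⟨g, l⟩ := p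
  change consOp x (inflation G (List G) (shiftOp a ψ) (star (consOp y) v)) (g, l) = _
  rw [consOp_apply, consMap, inflation_apply, shiftOp_apply, slice_apply, star_consOp_apply]
  -- The label written on the left at the point `g` is `x⁻¹ * g`; the one expected on the right, at
  -- the shifted point `a⁻¹ * g`, is `y⁻¹ * (a⁻¹ * g)`. They match exactly on the diagonal `x * y⁻¹
  -- = a`.
  have h : x⁻¹ * g = y⁻¹ * (a⁻¹ * g) ↔ x * y⁻¹ = a := by
    rw [← mul_assoc, mul_left_inj, inv_eq_iff_eq_inv, mul_inv_rev, inv_inv, inv_inv,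
      mul_inv_eq_iff_eq_mul]
  simp only [h]
  split_ifs
  · rw [inflation_apply, shiftOp_apply, slice_apply]
  · simp

end ConsOp

/-! ### Invertibility in Banach algebras -/

section BanachAlgebra

/-- `1 - x` is a commuting factor of `1 - x ^ n`, which a Neumann series inverts. Only a norm is
involved, so the criterion passes to closed subalgebras. -/
theorem isUnit_one_sub_of_pow {B : Type*} [NormedRing B] [CompleteSpace B] {x : B} {n : ℕ}
    (h : ‖x ^ n‖ < 1) : IsUnit (1 - x) := by
  have h1 : IsUnit (1 - x ^ n) := (Units.oneSub (x ^ n) h).isUnit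
  have h2 : (1 - x) * ∑ i ∈ Finset.range n, x ^ i = 1 - x ^ n := mul_neg_geom_sum x n
  have h3 : Commute (1 - x) (∑ i ∈ Finset.range n, x ^ i) :=
    Commute.sum_right _ _ _ fun i _ => ((Commute.one_left _).sub_left (Commute.refl x)).pow_right i
  rw [← h2, h3.isUnit_mul_iff] at h1
  exact h1.1

/-- If the spectrum of `F` is contained in `[δ, ∞)` with `δ > 0`, then some power of a suitable
`1 - c⁻¹ F` is small. -/
theorem exists_norm_one_sub_pow_lt_one {B : Type*} [NormedRing B] [NormedAlgebra ℂ B]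
    [CompleteSpace B] {F : B} {δ : ℝ} (hδ : 0 < δ)
    (h : ∀ z ∈ spectrum ℂ F, δ ≤ z.re ∧ z.im = 0) :
    ∃ (c : ℝ) (n : ℕ), 0 < c ∧ ‖(1 - (c : ℂ)⁻¹ • F) ^ n‖ < 1 := by
  -- An upper bound for the spectrum of `F` (the norm of 1 need not be 1), enlarged by `δ` to be
  -- positive. It places the spectrum of `1 - c⁻¹ F` in `[0, 1 - δ/c]`.
  set c : ℝ := ‖F‖ * ‖(1 : B)‖ + δ with hc
  have hc0 : 0 < c := by positivity
  have hcC : (c : ℂ) ≠ 0 := by exact_mod_cast hc0.ne'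
  set x : B := 1 - (c : ℂ)⁻¹ • F with hx
  have hq : δ / c ≤ 1 := by
    rw [div_le_one hc0, hc]
    have : 0 ≤ ‖F‖ * ‖(1 : B)‖ := by positivity
    linarith
  have hspec : ∀ w ∈ spectrum ℂ x, ‖w‖ ≤ 1 - δ / c := by
    intro w hw
    have h1 : (c : ℂ) * (1 - w) ∈ spectrum ℂ F := by
      rw [spectrum.mem_iff] at hw ⊢
      contrapose! hw
      have h2 : algebraMap ℂ B w - x
          = (-(c : ℂ)⁻¹) • (algebraMap ℂ B ((c : ℂ) * (1 - w)) - F) := by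
        simp only [hx, Algebra.algebraMap_eq_smul_one, smul_sub, smul_smul, neg_smul, neg_mul,
          sub_smul, mul_sub, mul_one]
        rw [inv_mul_cancel₀ hcC, inv_mul_cancel_left₀ hcC, one_smul]
        abel
      rw [h2]
      exact hw.smul (Units.mk0 (-(c : ℂ)⁻¹) (neg_ne_zero.2 (inv_ne_zero hcC)))
    obtain ⟨h2, h3⟩ := h _ h1
    have h4 := spectrum.norm_le_norm_mul_of_mem h1
    have him : w.im = 0 := by
      simpa [hc0.ne'] using h3
    have hre : δ ≤ c * (1 - w.re) := by simpa using h2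
    have hw' : w = (w.re : ℂ) := Complex.ext rfl (by simpa using him)
    have h5 : c * (1 - w.re) ≤ c := by
      have : ((c : ℂ) * (1 - w)).re ≤ ‖(c : ℂ) * (1 - w)‖ := Complex.re_le_norm _
      have h6 : ((c : ℂ) * (1 - w)).re = c * (1 - w.re) := by simp
      linarith
    have h7 : 0 ≤ w.re := by nlinarith
    rw [hw', Complex.norm_real, Real.norm_of_nonneg h7, le_sub_iff_add_le, ← le_sub_iff_add_le',
      div_le_iff₀ hc0]
    linarith
  have hrad : spectralRadius ℂ x < 1 := by
    refine lt_of_le_of_lt (iSup₂_le fun w hw => ?_) (b := ((1 - δ / c).toNNReal : ℝ≥0∞)) ?_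
    · rw [ENNReal.coe_le_coe, ← NNReal.coe_le_coe, Real.coe_toNNReal _ (by linarith), coe_nnnorm]
      exact hspec w hw
    · rw [ENNReal.coe_lt_one_iff, Real.toNNReal_lt_one]
      have : 0 < δ / c := by positivity
      linarith
  -- Gelfand's formula; `n ≥ 1` keeps the exponent `1/n` positive, so `‖x ^ n‖ ≥ 1` would force the
  -- `n`-th root to be at least 1.
  obtain ⟨n, hn, hn1⟩ := (((spectrum.pow_nnnorm_pow_one_div_tendsto_nhds_spectralRadius
    x).eventually (gt_mem_nhds hrad)).and (Filter.eventually_ge_atTop 1)).exists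
  refine ⟨c, n, hc0, ?_⟩
  by_contra hge
  rw [not_lt] at hge
  refine hn.not_ge (ENNReal.one_le_rpow ?_ (by positivity))
  rw [ENNReal.one_le_coe_iff, ← NNReal.coe_le_coe]
  simpa using hge

/-- In a symmetric Banach `*`-algebra all elements `1 + b* b` are invertible. -/
theorem IsSymmetricStarAlgebra.isUnit_one_add {B : Type*} [Ring B] [Algebra ℂ B] [Star B]
    (h : IsSymmetricStarAlgebra B) (b : B) : IsUnit (1 + star b * b) := by
  by_contra hn
  have h1 : (-1 : ℂ) ∈ spectrum ℂ (star b * b) := by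
    rw [spectrum.mem_iff]
    intro h2
    apply hn
    rw [← IsUnit.neg_iff]
    convert h2 using 1
    simp
    abel
  have h2 := h b (-1) (spectrum_subset_quasispectrum ℂ _ h1)
  norm_num at h2

/-- In a symmetric Banach `*`-algebra, limits of squares are nonnegative. -/
theorem IsSymmetricStarAlgebra.isUnit_add_of_approx {B : Type*} [NormedRing B] [NormedAlgebra ℂ B]
    [CompleteSpace B] [StarRing B] [StarModule ℂ B] [ContinuousStar B]
    (h : IsSymmetricStarAlgebra B) {x : B} (hx : IsSelfAdjoint x)
    (happrox : ∀ ε > 0, ∃ C : B, ‖x - star C * C‖ < ε) {t : ℝ} (ht : 0 < t) :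
    IsUnit (x + (t : ℂ) • 1) := by
  obtain ⟨ε, hε, hball⟩ :=
    Metric.eventually_nhds_iff.1 (eventually_exists_isSelfAdjoint_sq (B := B))
  obtain ⟨C, hC⟩ := happrox (ε * t) (by positivity)
  have htC : (t : ℂ) ≠ 0 := by exact_mod_cast ht.ne'
  have hreal : ∀ r : ℝ, star (r : ℂ) = r := Complex.conj_ofReal
  -- The self-adjoint element `1 + t⁻¹(x - C*C)` is close enough to 1 to have an invertible
  -- self-adjoint square root `d`.
  have hb : dist (1 + (t : ℂ)⁻¹ • (x - star C * C)) 1 < ε := by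
    rw [dist_eq_norm, add_sub_cancel_left, norm_smul, norm_inv, Complex.norm_real,
      Real.norm_of_nonneg ht.le, inv_mul_lt_iff₀ ht, mul_comm]
    exact hC
  obtain ⟨d, hd, hds, hdd⟩ := hball hb (by
    rw [isSelfAdjoint_iff]
    simp only [star_add, star_one, star_smul, star_sub, star_mul, star_star, hx.star_eq, star_inv₀,
      hreal])
  obtain ⟨d, rfl⟩ := hd
  have hdinv : star (↑d⁻¹ : B) = ↑d⁻¹ := by
    rw [← Units.coe_star_inv]
    congr 2
    exact Units.ext hds
  set r : ℂ := ((√t⁻¹ : ℝ) : ℂ) with hr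
  have hrr : r * r = (t : ℂ)⁻¹ := by
    rw [hr, ← Complex.ofReal_mul, Real.mul_self_sqrt (by positivity), Complex.ofReal_inv]
  have hunit := h.isUnit_one_add (r • (C * ↑d⁻¹))
  -- Since `x + t = t(d² + t⁻¹ C*C)`, pulling out `d` on both sides leaves `1 + (r C d⁻¹)*(r C d⁻¹)`
  -- with `r² = t⁻¹`, invertible by symmetry.
  have key : x + (t : ℂ) • 1
      = (t : ℂ) • (↑d * (1 + star (r • (C * ↑d⁻¹)) * (r • (C * ↑d⁻¹))) * ↑d) := by
    have h1 : (d : B) * (1 + star (r • (C * ↑d⁻¹)) * (r • (C * ↑d⁻¹))) * ↑d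
        = ↑d * ↑d + (t : ℂ)⁻¹ • (star C * C) := by
      rw [star_smul, star_mul, hdinv, hr, hreal, ← hr, smul_mul_smul_comm, hrr, mul_add, add_mul,
        mul_one, mul_smul_comm, smul_mul_assoc]
      congr 2
      simp [mul_assoc]
    rw [h1, hdd, smul_add, smul_add, smul_smul, smul_smul, mul_inv_cancel₀ htC, one_smul, one_smul]
    abel
  rw [key]
  exact ((d.isUnit.mul hunit).mul d.isUnit).smul (Units.mk0 (t : ℂ) htC)

end BanachAlgebra

theorem ContinuousLinearMap.exists_eq_star_mul_self {H : Type*} [NormedAddCommGroup H]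
    [InnerProductSpace ℂ H] [CompleteSpace H] {T : H →L[ℂ] H} (hT : 0 ≤ T) :
    ∃ R : H →L[ℂ] H, T = star R * R :=
  CStarAlgebra.nonneg_iff_eq_star_mul_self.1 hT

theorem EllOne.star_sum_single_mul_self {G B : Type*} [Group G] [NormedRing B] [CompleteSpace B]
    [NormedAlgebra ℂ B] [StarRing B] [NormedStarGroup B] [StarModule ℂ B] (s : Finset G)
    (ξ : G → ℝ) (b : G → B) :
    star (∑ y ∈ s, (ξ y : ℂ) • single y⁻¹ (b y)) * ∑ y ∈ s, (ξ y : ℂ) • single y⁻¹ (b y)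
      = ∑ x ∈ s, ∑ y ∈ s, ((ξ x * ξ y : ℝ) : ℂ) • single (x * y⁻¹) (star (b x) * b y) := by
  have hreal : ∀ r : ℝ, star (r : ℂ) = r := Complex.conj_ofReal
  rw [star_sum, Finset.sum_mul_sum]
  refine Finset.sum_congr rfl fun x _ => Finset.sum_congr rfl fun y _ => ?_
  rw [star_smul, star_single, inv_inv, smul_mul_smul_comm, single_mul_single, hreal,
    Complex.ofReal_mul]

/-! ### Positivity and invertibility in `ℓ¹(G; 𝔹(ℓ²(G)))` -/

section Positivity

universe u
variable {G : Type u} [Group G]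

/-- Compression is continuous, so it may be applied termwise to the sum, and only the diagonal `x *
y⁻¹` survives. Thus the summed operator alone determines every value of `f`. -/
theorem consOp_mul_inflation_sumHom (f : EllOne G (EllTwo G →L[ℂ] EllTwo G))
    (hf : ∀ a, ∃ ψ, f a = shiftOp a ψ) (x y : G) :
    consOp x * inflation G (List G) (EllOne.sumHom f) * star (consOp y)
      = inflation G (List G) (f (x * y⁻¹)) := by
  classical
  have hc : Continuous (inflation G (List G)) :=
    (AddMonoidHomClass.isometry_of_norm _ norm_inflation).continuous
  have h1 := ((((EllOne.hasSum_sumHom f).map (inflation G (List G)) hc).mul_left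
    (consOp x)).mul_right (star (consOp y)))
  refine h1.unique ?_
  convert hasSum_single (x * y⁻¹) fun a ha => ?_ using 1
  · obtain ⟨ψ, hψ⟩ := hf (x * y⁻¹)
    simp only [Function.comp_apply]
    rw [hψ, consOp_mul_inflation_shiftOp, if_pos rfl]
  · obtain ⟨ψ, hψ⟩ := hf a
    simp only [Function.comp_apply]
    rw [hψ, consOp_mul_inflation_shiftOp, if_neg (Ne.symm ha)]

/-- If `f` sums to a positive operator, then its product with a coefficient function of the regular
representation is a square in `ℓ¹(G; 𝔹(ℓ²(G × List G)))`. -/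
theorem exists_star_mul_self_eq_regularCoeff (f : EllOne G (EllTwo G →L[ℂ] EllTwo G))
    (hf : ∀ a, ∃ ψ, f a = shiftOp a ψ) (hpos : 0 ≤ EllOne.sumHom f) (s : Finset G) (ξ : G → ℝ) :
    ∃ C : EllOne G (EllTwo (G × List G) →L[ℂ] EllTwo (G × List G)), ∀ a,
      (star C * C) a = (regularCoeff s ξ a : ℂ) • inflation G (List G) (f a) := by
  classical
  obtain ⟨r, hr⟩ := ContinuousLinearMap.exists_eq_star_mul_self hpos
  let R := inflation G (List G) r
  -- In `C*C` the pair `(x, y)` contributes, at `x * y⁻¹`, the weight `ξ x * ξ y` times the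
  -- compression of `R*R`, the inflated sum of `f`; that compression is the inflation of `f (x *
  -- y⁻¹)`.
  let C : EllOne G (EllTwo (G × List G) →L[ℂ] EllTwo (G × List G)) :=
    ∑ y ∈ s, (ξ y : ℂ) • EllOne.single y⁻¹ (R * star (consOp y))
  have h1 : star C * C = ∑ x ∈ s, ∑ y ∈ s, ((ξ x * ξ y : ℝ) : ℂ) •
      EllOne.single (x * y⁻¹) (inflation G (List G) (f (x * y⁻¹))) := by
    refine (EllOne.star_sum_single_mul_self s ξ fun y => R * star (consOp y)).trans ?_
    refine Finset.sum_congr rfl fun x _ => Finset.sum_congr rfl fun y _ => ?_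
    congr 2
    rw [← consOp_mul_inflation_sumHom f hf x y, hr, map_mul, map_star]
    simp only [R, mul_assoc, star_mul, star_star]
  refine ⟨C, fun a => ?_⟩
  rw [h1, regularCoeff, EllOne.finset_sum_apply, Complex.ofReal_sum, Finset.sum_smul]
  refine Finset.sum_congr rfl fun x _ => ?_
  rw [EllOne.finset_sum_apply, Complex.ofReal_sum, Finset.sum_smul]
  refine Finset.sum_congr rfl fun y _ => ?_
  rw [EllOne.smul_apply]
  by_cases h : x * y⁻¹ = a
  · rw [h, EllOne.single_apply_self, if_pos rfl]
  · rw [EllOne.single_apply_ne (Ne.symm h), if_neg h, smul_zero, Complex.ofReal_zero, zero_smul]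

end Positivity

/-! ### Inverse closedness -/

/-- The factor `1 - φ` is at most `η` on `E` and at most 1 off `E`, where only the tail of `f`
remains. -/
theorem EllOne.norm_le_of_norm_apply_le {G A B : Type*} [NormedAddCommGroup A]
    [NormedAddCommGroup B] {z : EllOne G B} {f : EllOne G A} {φ : G → ℝ} {E : Finset G} {η : ℝ}
    (hz : ∀ a, ‖z a‖ ≤ (1 - φ a) * ‖f a‖) (hφ : ∀ a, 0 ≤ φ a) (hE : ∀ a ∈ E, 1 - φ a ≤ η)
    (hη : 0 ≤ η) : ‖z‖ ≤ η * ‖f‖ + (‖f‖ - ∑ a ∈ E, ‖f a‖) := by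
  classical
  have h1 := f.summable_norm.hasSum
  rw [← norm_eq_tsum] at h1
  have h2 : HasSum (fun a => if a ∈ E then ‖f a‖ else 0) (∑ a ∈ E, ‖f a‖) := by
    have h := hasSum_sum_of_ne_finset_zero (f := fun a => if a ∈ E then ‖f a‖ else 0) (s := E)
      (L := SummationFilter.unconditional G) (fun a ha => if_neg ha)
    rwa [Finset.sum_congr rfl fun a ha => if_pos ha] at h
  have h3 := z.summable_norm.hasSum
  rw [← norm_eq_tsum] at h3
  refine hasSum_le (fun a => ?_) h3 ((h1.mul_left η).add (h1.sub h2))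
  have h4 := norm_nonneg (f a)
  refine (hz a).trans ?_
  split_ifs with ha
  · have := mul_le_mul_of_nonneg_right (hE a ha) h4
    linarith
  · have := mul_nonneg hη h4
    nlinarith [hφ a]

theorem ContinuousLinearMap.exists_pos_le_star_mul_self {H : Type*} [NormedAddCommGroup H]
    [InnerProductSpace ℂ H] [CompleteSpace H] {T : H →L[ℂ] H} (hT : IsUnit T) :
    ∃ δ : ℝ, 0 < δ ∧ 0 ≤ star T * T - (δ : ℂ) • 1 := by
  obtain ⟨T, rfl⟩ := hT
  set S : H →L[ℂ] H := ↑T⁻¹ with hS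
  -- The summand 1 keeps the constant positive even when `S = 0`.
  have hb : ∀ v, ‖v‖ ≤ (‖S‖ + 1) * ‖(T : H →L[ℂ] H) v‖ := fun v => by
    have h1 : S ((T : H →L[ℂ] H) v) = v := by
      change (S * (T : H →L[ℂ] H)) v = v
      rw [hS, Units.inv_mul]
      rfl
    have h2 := S.le_opNorm ((T : H →L[ℂ] H) v)
    rw [h1] at h2
    nlinarith [norm_nonneg ((T : H →L[ℂ] H) v)]
  have hpos : 0 < ‖S‖ + 1 := by positivity
  refine ⟨((‖S‖ + 1) ^ 2)⁻¹, by positivity, ?_⟩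
  rw [ContinuousLinearMap.nonneg_iff_isPositive, ContinuousLinearMap.isPositive_iff_complex]
  intro v
  have h1 : inner ℂ ((star (T : H →L[ℂ] H) * (T : H →L[ℂ] H)
      - ((((‖S‖ + 1) ^ 2)⁻¹ : ℝ) : ℂ) • 1) v) v
      = ((‖(T : H →L[ℂ] H) v‖ ^ 2 - ((‖S‖ + 1) ^ 2)⁻¹ * ‖v‖ ^ 2 : ℝ) : ℂ) := by
    change inner ℂ (ContinuousLinearMap.adjoint (T : H →L[ℂ] H) ((T : H →L[ℂ] H) v)
      - ((((‖S‖ + 1) ^ 2)⁻¹ : ℝ) : ℂ) • v) v = _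
    rw [inner_sub_left, inner_smul_left, ContinuousLinearMap.adjoint_inner_left,
      inner_self_eq_norm_sq_to_K, inner_self_eq_norm_sq_to_K, Complex.conj_ofReal]
    push_cast
    rfl
  rw [h1]
  refine ⟨congrArg Complex.ofReal (Complex.ofReal_re _), ?_⟩
  rw [RCLike.re_eq_complex_re, Complex.ofReal_re, sub_nonneg]
  have h2 := pow_le_pow_left₀ (norm_nonneg v) (hb v) 2
  rw [mul_pow] at h2
  exact (inv_mul_le_iff₀ (by positivity)).2 h2

theorem isSelfAdjoint_star_mul_self_sub_smul_one {B : Type*} [Ring B] [StarRing B] [Algebra ℂ B]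
    [StarModule ℂ B] (b : B) (δ : ℝ) : IsSelfAdjoint (star b * b - (δ : ℂ) • 1) := by
  rw [isSelfAdjoint_iff, star_sub, star_smul, star_one, Complex.star_def, Complex.conj_ofReal,
    star_mul, star_star]

/-- A criterion for invertibility in a closed `*`-subalgebra of a Banach `*`-algebra which embeds
isometrically into a symmetric one. -/
theorem IsSymmetricStarAlgebra.isUnit_star_mul_self {B C : Type*} [NormedRing B] [NormedAlgebra ℂ B]
    [CompleteSpace B] [StarRing B] [StarModule ℂ B] [NormedRing C] [NormedAlgebra ℂ C]
    [CompleteSpace C] [StarRing C] [StarModule ℂ C] (hC : IsSymmetricStarAlgebra C)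
    (τ : B →⋆ₐ[ℂ] C) (hτ : ∀ b, ‖τ b‖ = ‖b‖) {D : StarSubalgebra ℂ B} (hD : IsClosed (D : Set B))
    (h : D) {δ : ℝ} (hδ : 0 < δ)
    (hunit : ∀ t : ℝ, 0 < t →
      IsUnit (τ (star (h : B) * h - (δ : ℂ) • 1) + (t : ℂ) • 1)) :
    IsUnit (star h * h) := by
  have : CompleteSpace D := hD.completeSpace_coe
  set f : B := star (h : B) * h with hf
  have hspec : ∀ z ∈ spectrum ℂ (τ f), δ ≤ z.re ∧ z.im = 0 := by
    intro z hz
    have hτ : τ f = star (τ h) * τ h := by rw [hf, map_mul, map_star]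
    obtain ⟨h1, h2⟩ := hC (τ h) z (spectrum_subset_quasispectrum ℂ _ (hτ ▸ hz))
    refine ⟨?_, h2⟩
    -- Symmetry has already made `z` real. If `z < δ`, then `t = δ - z > 0` and `f - z = (f - δ) +
    -- t` is invertible by `hunit`.
    by_contra hlt
    rw [not_le] at hlt
    rw [spectrum.mem_iff] at hz
    apply hz
    rw [← IsUnit.neg_iff]
    convert hunit _ (sub_pos.2 hlt) using 1
    have hz' : z = (z.re : ℂ) := Complex.ext rfl (by simpa using h2)
    rw [map_sub, map_smul, map_one, Algebra.algebraMap_eq_smul_one, Complex.ofReal_sub, sub_smul,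
      ← hz']
    abel
  obtain ⟨c, n, hc, hn⟩ := exists_norm_one_sub_pow_lt_one hδ hspec
  -- The isometry `τ` brings the norm bound back to the subalgebra, where the inverse is then
  -- constructed.
  have hn' : ‖(1 - (c : ℂ)⁻¹ • (star h * h)) ^ n‖ < 1 := by
    have h1 : τ ((1 - (c : ℂ)⁻¹ • f) ^ n) = (1 - (c : ℂ)⁻¹ • τ f) ^ n := by
      rw [map_pow, map_sub, map_one, map_smul]
    rw [← h1, hτ] at hn
    exact hn
  have h1 := isUnit_one_sub_of_pow hn'
  rw [sub_sub_cancel] at h1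
  have hcC : (c : ℂ) ≠ 0 := by exact_mod_cast hc.ne'
  have h2 := h1.smul (Units.mk0 (c : ℂ) hcC)
  rwa [Units.smul_mk0, smul_inv_smul₀ hcC] at h2

section InverseClosed

universe u
variable {G : Type u} [Group G]

theorem IsRigidlySymmetric.isSymmetricStarAlgebra (h : IsRigidlySymmetric G) (B : Type u)
    [CStarAlgebra B] : IsSymmetricStarAlgebra (EllOne G B) := h B

/-- The inflated `f` is a limit of elements `C*C`: it differs from its product with a regular
coefficient by little, once that coefficient is near 1 on a finite set carrying most of the norm of
`f`. -/
theorem isUnit_mapHom_add (hamen : IsAmenableGroup G) (hsymm : IsRigidlySymmetric G)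
    (f : EllOne G (EllTwo G →L[ℂ] EllTwo G)) (hf : ∀ a, ∃ ψ, f a = shiftOp a ψ)
    (hsa : IsSelfAdjoint f) (hpos : 0 ≤ EllOne.sumHom f) {t : ℝ} (ht : 0 < t) :
    IsUnit (EllOne.mapHom (inflation G (List G)) norm_inflation f + (t : ℂ) • 1) := by
  have hB := hsymm.isSymmetricStarAlgebra (EllTwo (G × List G) →L[ℂ] EllTwo (G × List G))
  refine hB.isUnit_add_of_approx (hsa.map _) (fun ε hε => ?_) ht
  obtain ⟨E, hE⟩ := f.exists_finset_sum_norm_lt (half_pos hε)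
  -- Half of `ε` pays for the tail of `f` off `E`, half for the defect `η‖f‖` of the coefficient on
  -- `E`.
  have hη : 0 < ε / 2 / (‖f‖ + 1) := by positivity
  obtain ⟨s, ξ, -, h01, hηE⟩ := hamen.exists_regularCoeff E hη
  obtain ⟨C, hC⟩ := exists_star_mul_self_eq_regularCoeff f hf hpos s ξ
  refine ⟨C, ?_⟩
  have h1 := EllOne.norm_le_of_norm_apply_le
    (z := EllOne.mapHom (inflation G (List G)) norm_inflation f - star C * C) (f := f)
    (φ := regularCoeff s ξ) (E := E) (η := ε / 2 / (‖f‖ + 1)) (fun a => ?_) (fun a => (h01 a).1) hηE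
    hη.le
  · have h2 : ε / 2 / (‖f‖ + 1) * ‖f‖ ≤ ε / 2 := by
      rw [div_mul_eq_mul_div, div_le_iff₀ (by positivity)]
      nlinarith [norm_nonneg f]
    linarith
  · rw [EllOne.sub_apply, hC, EllOne.mapHom_apply]
    have h3 : inflation G (List G) (f a) - (regularCoeff s ξ a : ℂ) • inflation G (List G) (f a)
        = ((1 - regularCoeff s ξ a : ℝ) : ℂ) • inflation G (List G) (f a) := by
      rw [Complex.ofReal_sub, sub_smul, Complex.ofReal_one, one_smul]
    rw [h3, norm_smul, norm_inflation, Complex.norm_real, Real.norm_of_nonneg]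
    linarith [(h01 a).2]

variable {ω : G → G → EllInfty G} {A : StarSubalgebra ℂ (EllInfty G)}
  {hA : IsClosed (A : Set (EllInfty G))} {hAtrans : ∀ (x : G), ∀ φ ∈ A, leftTranslate x φ ∈ A}
  {hω : IsTwoCocycle ω} {hωA : ∀ x y, ω x y ∈ A}

theorem exists_eq_shiftOp_of_mem {f : EllOne G (EllTwo G →L[ℂ] EllTwo G)}
    (hf : f ∈ twistedAlgebra A hA hAtrans hω hωA) (a : G) : ∃ ψ, f a = shiftOp a ψ := by
  obtain ⟨φ, -, h⟩ := mem_twistedFiber.1 (hf a)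
  exact ⟨_, h.symm⟩

/-- An invertible operator is bounded below, so `h*h - δ` sums to a positive operator for some `δ >
0`, and its inflation is invertible after adding any `t > 0`. -/
theorem isUnit_star_mul_self_of_sumHom (hamen : IsAmenableGroup G) (hsymm : IsRigidlySymmetric G)
    (h : twistedAlgebra A hA hAtrans hω hωA)
    (hu : IsUnit (EllOne.sumHom (h : EllOne G (EllTwo G →L[ℂ] EllTwo G)))) :
    IsUnit (star h * h) := by
  have hB := hsymm.isSymmetricStarAlgebra (EllTwo (G × List G) →L[ℂ] EllTwo (G × List G))
  obtain ⟨δ, hδ, hpos⟩ := ContinuousLinearMap.exists_pos_le_star_mul_self hu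
  refine hB.isUnit_star_mul_self (EllOne.mapHom (inflation G (List G)) norm_inflation)
    (EllOne.norm_mapHom _ _) (isClosed_twistedAlgebra hA hAtrans hω hωA) h hδ fun t ht => ?_
  have h1 : star h.1 * h.1 ∈ twistedAlgebra A hA hAtrans hω hωA := (star h * h).2
  have h2 : ((δ : ℂ) • 1 : EllOne G (EllTwo G →L[ℂ] EllTwo G)) ∈
      twistedAlgebra A hA hAtrans hω hωA := StarSubalgebra.smul_mem _ (one_mem _) _
  have hmem : star h.1 * h.1 - (δ : ℂ) • 1 ∈ twistedAlgebra A hA hAtrans hω hωA :=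
    fun a => Submodule.sub_mem _ (h1 a) (h2 a)
  refine isUnit_mapHom_add hamen hsymm _ (exists_eq_shiftOp_of_mem hmem) ?_ ?_ ht
  · exact isSelfAdjoint_star_mul_self_sub_smul_one h.1 δ
  · rw [map_sub, map_smul, map_one, map_mul, map_star]
    exact hpos

/-- The algebra `twistedAlgebra` is spectrally invariant in `𝔹(ℓ²(G))`. -/
theorem isUnit_of_sumHom (hamen : IsAmenableGroup G) (hsymm : IsRigidlySymmetric G)
    (h : twistedAlgebra A hA hAtrans hω hωA)
    (hu : IsUnit (EllOne.sumHom (h : EllOne G (EllTwo G →L[ℂ] EllTwo G)))) : IsUnit h := by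
  have hu' : IsUnit (EllOne.sumHom
      (star h : twistedAlgebra A hA hAtrans hω hωA).1) := by
    have : EllOne.sumHom (star h : twistedAlgebra A hA hAtrans hω hωA).1
        = star (EllOne.sumHom h.1) := map_star EllOne.sumHom h.1
    rw [this]
    exact hu.star
  -- Inverting `h*h` gives a left inverse of `h`, inverting `hh*` a right inverse.
  obtain ⟨g, hg⟩ := isUnit_iff_exists.1 (isUnit_star_mul_self_of_sumHom hamen hsymm h hu)
  obtain ⟨k, hk⟩ := isUnit_iff_exists.1 (isUnit_star_mul_self_of_sumHom hamen hsymm (star h) hu')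
  rw [star_star] at hk
  refine isUnit_iff_exists_and_exists.2 ⟨⟨star h * k, ?_⟩, ⟨g * star h, ?_⟩⟩
  · rw [← mul_assoc]; exact hk.1
  · rw [mul_assoc]; exact hg.2

end InverseClosed

/-! ### Riesz calculus for elements with an isolated singular point -/

section Riesz

theorem ContinuousLinearMap.circleIntegral_comp {E F : Type*} [NormedAddCommGroup E]
    [NormedSpace ℂ E] [CompleteSpace E] [NormedAddCommGroup F] [NormedSpace ℂ F] [CompleteSpace F]
    (L : E →L[ℂ] F) {f : ℂ → E} {c : ℂ} {R : ℝ} (hf : CircleIntegrable f c R) :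
    L (∮ z in C(c, R), f z) = ∮ z in C(c, R), L (f z) := by
  rw [circleIntegral, circleIntegral, ← ContinuousLinearMap.intervalIntegral_comp_comm L hf.out]
  simp only [map_smul]

theorem Ring.inverse_eq_of_mul_eq_one {B : Type*} [Ring B] {x y : B} (h1 : x * y = 1)
    (h2 : y * x = 1) : Ring.inverse x = y :=
  Ring.inverse_unit ⟨x, y, h1, h2⟩

theorem map_ringInverse_of_isUnit {B C : Type*} [Ring B] [Ring C] (φ : B →+* C) {x : B}
    (hx : IsUnit x) : φ (Ring.inverse x) = Ring.inverse (φ x) := by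
  refine (Ring.inverse_eq_of_mul_eq_one ?_ ?_).symm
  · rw [← map_mul, Ring.mul_inverse_cancel x hx, map_one]
  · rw [← map_mul, Ring.inverse_mul_cancel x hx, map_one]

variable {B : Type*} [NormedRing B] [NormedAlgebra ℂ B] [CompleteSpace B]

theorem isUnit_one_sub_smul {b : B} {z : ℂ} (hz : ‖z‖ * ‖b‖ < 1) : IsUnit (1 - z • b) :=
  (Units.oneSub (z • b) ((norm_smul_le z b).trans_lt hz)).isUnit

/-- The resolvent of an element `a` with generalized inverse `b` and null idempotent `p`. -/
theorem sub_smul_one_mul_eq_one {a b p : B} (hab : a * b = 1 - p) (hba : b * a = 1 - p)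
    (hap : a * p = 0) (hpa : p * a = 0) (hbp : b * p = 0) (hpb : p * b = 0) {z : ℂ} (hz0 : z ≠ 0)
    (hz : ‖z‖ * ‖b‖ < 1) :
    (a - z • 1) * (b * Ring.inverse (1 - z • b) - z⁻¹ • p) = 1 ∧
      (b * Ring.inverse (1 - z • b) - z⁻¹ • p) * (a - z • 1) = 1 := by
  have hu := isUnit_one_sub_smul hz
  -- On the range of `1 - p` the resolvent is `b(1 - zb)⁻¹`; on the range of `p`, where `a`
  -- vanishes, it is `-z⁻¹`.
  set w := Ring.inverse (1 - z • b) with hw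
  have hw1 : (1 - z • b) * w = 1 := Ring.mul_inverse_cancel _ hu
  have hw2 : w * (1 - z • b) = 1 := Ring.inverse_mul_cancel _ hu
  have hpw : p * w = p := by
    have : p * (1 - z • b) = p := by rw [mul_sub, mul_one, mul_smul_comm, hpb, smul_zero, sub_zero]
    calc p * w = p * (1 - z • b) * w := by rw [this]
      _ = p := by rw [mul_assoc, hw1, mul_one]
  have hwp : w * p = p := by
    have : (1 - z • b) * p = p := by rw [sub_mul, one_mul, smul_mul_assoc, hbp, smul_zero, sub_zero]
    calc w * p = w * ((1 - z • b) * p) := by rw [this]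
      _ = p := by rw [← mul_assoc, hw2, one_mul]
  have hbw : b * w = w * b := by
    have : Commute (1 - z • b) b := (Commute.one_left b).sub_left ((Commute.refl b).smul_left z)
    calc b * w = w * (1 - z • b) * b * w := by rw [hw2, one_mul]
      _ = w * b * ((1 - z • b) * w) := by rw [mul_assoc w, this.eq]; simp only [mul_assoc]
      _ = w * b := by rw [hw1, mul_one]
  constructor
  · have h1 : (a - z • 1) * (b * w) = 1 - p := by
      calc (a - z • 1) * (b * w) = (a * b - z • b) * w := by
            rw [sub_mul, sub_mul, smul_mul_assoc, one_mul, smul_mul_assoc, mul_assoc]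
        _ = (1 - z • b) * w - p * w := by rw [hab, ← sub_mul]; congr 1; abel
        _ = 1 - p := by rw [hw1, hpw]
    rw [mul_sub, h1, mul_smul_comm, sub_mul, hap, smul_mul_assoc, one_mul, zero_sub, smul_neg,
      inv_smul_smul₀ hz0]
    abel
  · have h1 : (b * w) * (a - z • 1) = 1 - p := by
      calc (b * w) * (a - z • 1) = w * (b * a - z • b) := by
            rw [hbw, mul_sub, mul_sub, mul_smul_comm, mul_one, mul_smul_comm, mul_assoc]
        _ = w * (1 - z • b) - w * p := by rw [hba, ← mul_sub]; congr 1; abel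
        _ = 1 - p := by rw [hw2, hwp]
    rw [sub_mul, h1, smul_mul_assoc, mul_sub, hpa, mul_smul_comm, mul_one, zero_sub, smul_neg,
      inv_smul_smul₀ hz0]
    abel

/-- After division by `z` the singular part of the resolvent is `-z⁻² p`, which integrates to zero.
The rest is `z⁻¹` times a function holomorphic on the disc with value `b` at 0, so Cauchy's formula
applies. -/
theorem circleIntegral_inv_smul_resolvent {a b p : B} (hab : a * b = 1 - p) (hba : b * a = 1 - p)
    (hap : a * p = 0) (hpa : p * a = 0) (hbp : b * p = 0) (hpb : p * b = 0) {r : ℝ} (hr : 0 < r)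
    (hrb : r * ‖b‖ < 1) :
    (∮ z in C(0, r), z⁻¹ • Ring.inverse (a - z • 1)) = (2 * Real.pi * Complex.I : ℂ) • b := by
  have hdiff : ∀ z : ℂ, ‖z‖ ≤ r →
      DifferentiableAt ℂ (fun z : ℂ => b * Ring.inverse (1 - z • b)) z := by
    intro z hz
    have hu : IsUnit (1 - z • b) :=
      isUnit_one_sub_smul ((mul_le_mul_of_nonneg_right hz (norm_nonneg b)).trans_lt hrb)
    have h1 : DifferentiableAt ℂ (fun z : ℂ => 1 - z • b) z := by fun_prop
    exact ((differentiableAt_inverse hu).comp z h1).const_mul b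
  have hcont : ContinuousOn (fun z : ℂ => b * Ring.inverse (1 - z • b)) (Metric.closedBall 0 r) :=
    fun z hz => (hdiff z (by simpa using hz)).continuousAt.continuousWithinAt
  have h0 : ∀ z ∈ Metric.sphere (0 : ℂ) r, z ≠ 0 := by
    rintro z hz rfl
    simp [hr.ne] at hz
  have h1 : (∮ z in C(0, r), z⁻¹ • Ring.inverse (a - z • 1))
      = ∮ z in C(0, r), ((z - 0)⁻¹ • (b * Ring.inverse (1 - z • b)) - (z - 0) ^ (-2 : ℤ) • p) := by
    refine circleIntegral.integral_congr hr.le fun z hz => ?_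
    have hz' : ‖z‖ = r := by simpa using hz
    obtain ⟨h2, h3⟩ := sub_smul_one_mul_eq_one hab hba hap hpa hbp hpb (h0 z hz) (hz' ▸ hrb)
    simp only [sub_zero]
    rw [Ring.inverse_eq_of_mul_eq_one h2 h3, smul_sub, smul_smul, zpow_neg, ← mul_inv]
    norm_cast
    rw [sq]
  have hinv : ContinuousOn (fun z : ℂ => (z - 0)⁻¹) (Metric.sphere 0 r) :=
    ContinuousOn.inv₀ (by fun_prop) fun z hz => by simpa using h0 z hz
  rw [h1, circleIntegral.integral_sub, circleIntegral.integral_smul_const,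
    circleIntegral.integral_sub_zpow_of_ne (by norm_num), zero_smul, sub_zero,
    Complex.circleIntegral_sub_inv_smul_of_differentiable_on_off_countable Set.countable_empty
      (by simpa using hr) hcont fun z hz => hdiff z (by simpa using (Metric.mem_ball.1 hz.1).le)]
  · simp
  · exact (hinv.smul (hcont.mono Metric.sphere_subset_closedBall)).circleIntegrable hr.le
  · refine ContinuousOn.circleIntegrable hr.le (ContinuousOn.smul ?_ continuousOn_const)
    exact ContinuousOn.zpow₀ (by fun_prop) _ fun z hz => Or.inl (by simpa using h0 z hz)

/-- Generalized inverses lie in spectrally invariant Banach subalgebras. -/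
theorem exists_map_eq_of_generalized_inverse {D : Type*} [NormedRing D] [NormedAlgebra ℂ D]
    [CompleteSpace D] (Θ : D →ₐ[ℂ] B) (hΘ : Continuous Θ) (hunit : ∀ d, IsUnit (Θ d) → IsUnit d)
    {f : D} {a b p : B} (hf : Θ f = a) (hab : a * b = 1 - p) (hba : b * a = 1 - p)
    (hap : a * p = 0) (hpa : p * a = 0) (hbp : b * p = 0) (hpb : p * b = 0) :
    ∃ s : D, Θ s = b := by
  have hb : 0 < ‖b‖ + 1 := by positivity
  set r : ℝ := (‖b‖ + 1)⁻¹ with hr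
  have hr0 : 0 < r := inv_pos.2 hb
  have hrb : r * ‖b‖ < 1 := by
    rw [hr, inv_mul_lt_iff₀ hb]
    linarith
  have h0 : ∀ z ∈ Metric.sphere (0 : ℂ) r, z ≠ 0 := by
    rintro z hz rfl
    simp [hr0.ne] at hz
  have hmap : ∀ z : ℂ, Θ (f - z • 1) = a - z • 1 := fun z => by
    rw [map_sub, map_smul, map_one, hf]
  -- The resolvent of `a` exists on the whole circle, so spectral invariance puts the resolvent of
  -- `f` in `D`, and the contour integral can be taken there.
  have hu : ∀ z ∈ Metric.sphere (0 : ℂ) r, IsUnit (f - z • 1) := by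
    intro z hz
    have hz' : ‖z‖ = r := by simpa using hz
    obtain ⟨h2, h3⟩ := sub_smul_one_mul_eq_one hab hba hap hpa hbp hpb (h0 z hz) (hz' ▸ hrb)
    refine hunit _ ?_
    rw [hmap]
    exact isUnit_iff_exists.2 ⟨_, h2, h3⟩
  have hint : CircleIntegrable (fun z : ℂ => z⁻¹ • Ring.inverse (f - z • 1)) 0 r := by
    refine ContinuousOn.circleIntegrable hr0.le (ContinuousOn.smul ?_ ?_)
    · exact ContinuousOn.inv₀ continuousOn_id h0
    · intro z hz
      have h1 : ContinuousAt (fun z : ℂ => f - z • (1 : D)) z := by fun_prop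
      exact (ContinuousAt.comp (f := fun z : ℂ => f - z • (1 : D))
        (NormedRing.inverse_continuousAt (hu z hz).unit) h1).continuousWithinAt
  let L : D →L[ℂ] B := ⟨Θ.toLinearMap, hΘ⟩
  refine ⟨(2 * Real.pi * Complex.I : ℂ)⁻¹ • ∮ z in C(0, r), z⁻¹ • Ring.inverse (f - z • 1), ?_⟩
  have h1 : L (∮ z in C(0, r), z⁻¹ • Ring.inverse (f - z • 1))
      = (2 * Real.pi * Complex.I : ℂ) • b := by
    rw [L.circleIntegral_comp hint,
      ← circleIntegral_inv_smul_resolvent hab hba hap hpa hbp hpb hr0 hrb]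
    refine circleIntegral.integral_congr hr0.le fun z hz => ?_
    have h2 := map_ringInverse_of_isUnit (Θ : D →+* B) (hu z hz)
    change L (z⁻¹ • Ring.inverse (f - z • 1)) = _
    rw [map_smul]
    congr 1
    rw [← hmap]
    exact h2
  rw [map_smul]
  change _ • L _ = b
  rw [h1, inv_smul_smul₀ Complex.two_pi_I_ne_zero]

end Riesz

/-! ### Fredholm operators on Hilbert spaces -/

section Fredholm

variable {H : Type*} [NormedAddCommGroup H] [InnerProductSpace ℂ H] [CompleteSpace H]

theorem isCompactOperator_of_finiteDimensional_range (q : H →L[ℂ] H)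
    (hq : FiniteDimensional ℂ q.range) : IsCompactOperator q := by
  have : ProperSpace q.range := FiniteDimensional.proper ℂ _
  exact (isCompactOperator_of_locallyCompactSpace_dom
    (q.codRestrict q.range fun x => ⟨x, rfl⟩)).clm_comp q.range.subtypeL

/-- `q` factors through the finite-dimensional quotient by the range of `T`, hence has finite rank.
-/
theorem isCompactOperator_of_mul_eq_zero {q T : H →L[ℂ] H} (hT : T.range.CoFG) (h : q * T = 0) :
    IsCompactOperator q := by
  refine isCompactOperator_of_finiteDimensional_range q ?_
  have : FiniteDimensional ℂ (H ⧸ T.range) := hT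
  have hle : T.range ≤ q.ker := by
    rintro _ ⟨v, rfl⟩
    exact congrArg (fun S : H →L[ℂ] H => S v) h
  have h1 : q.range = LinearMap.range (T.range.liftQ (q : H →ₗ[ℂ] H) hle) :=
    (Submodule.range_liftQ _ _ _).symm
  rw [h1]
  infer_instance

/-- A Fredholm operator is bounded below on the orthogonal complement of its kernel. -/
theorem ContinuousLinearMap.IsFredholm.exists_le_norm {T : H →L[ℂ] H} (hT : T.IsFredholm) :
    ∃ c : ℝ, 0 < c ∧ ∀ v ∈ T.kerᗮ, c * ‖v‖ ≤ ‖T v‖ := by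
  have := hT.finite_ker
  let T' : T.kerᗮ →L[ℂ] H := T.comp T.kerᗮ.subtypeL
  have hinj : Function.Injective T' := by
    rw [injective_iff_map_eq_zero]
    rintro ⟨v, hv⟩ h
    have h1 : v ∈ T.ker := h
    exact Subtype.ext (inner_self_eq_zero.1 (hv v h1))
  -- Restricting to the complement of the kernel loses nothing from the range, which is closed; an
  -- injective operator with closed range is bounded below.
  have hrange : Set.range T' = Set.range T := by
    refine Set.Subset.antisymm ?_ ?_
    · rintro _ ⟨v, rfl⟩
      exact ⟨v, rfl⟩
    · rintro _ ⟨v, rfl⟩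
      refine ⟨⟨v - T.ker.starProjection v, Submodule.sub_starProjection_mem_orthogonal v⟩, ?_⟩
      have h1 : T (T.ker.starProjection v) = 0 := Submodule.starProjection_apply_mem T.ker v
      change T (v - T.ker.starProjection v) = T v
      rw [map_sub, h1, sub_zero]
  obtain ⟨K, hK⟩ := T'.antilipschitz_of_injective_of_isClosed_range hinj
    (by rw [hrange]; exact hT.isClosed_range)
  refine ⟨((K : ℝ) + 1)⁻¹, by positivity, fun v hv => ?_⟩
  rw [inv_mul_le_iff₀ (by positivity)]
  have h1 : ‖v‖ ≤ K * ‖T v‖ := by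
    have := hK.le_mul_dist ⟨v, hv⟩ 0
    rw [map_zero, dist_zero_right, dist_zero_right] at this
    exact this
  linarith [norm_nonneg (T v)]

/-- With `p` the projection onto the kernel, `T*T + p` is coercive, hence invertible, and it is the
identity on the kernel. Subtracting `p` from its inverse leaves the generalized inverse of `T*T`. -/
theorem ContinuousLinearMap.IsFredholm.exists_generalized_inverse {T : H →L[ℂ] H}
    (hT : T.IsFredholm) : ∃ b p : H →L[ℂ] H, IsCompactOperator p ∧ T * p = 0 ∧
      (star T * T) * b = 1 - p ∧ b * (star T * T) = 1 - p ∧ p * (star T * T) = 0 ∧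
      b * p = 0 ∧ p * b = 0 := by
  have := hT.finite_ker
  obtain ⟨c, hc, hbound⟩ := hT.exists_le_norm
  set p : H →L[ℂ] H := T.ker.starProjection with hp
  have hTp : T * p = 0 := by
    ext v
    exact Submodule.starProjection_apply_mem T.ker v
  have hpp : p * p = p := Submodule.isIdempotentElem_starProjection T.ker
  have hps : star p = p := isSelfAdjoint_starProjection T.ker
  have hpT : p * star T = 0 := by
    have := congrArg star hTp
    rwa [star_mul, hps, star_zero] at this
  have hpc : IsCompactOperator p := by
    refine isCompactOperator_of_finiteDimensional_range p ?_
    have : p.range = T.ker := Submodule.range_starProjection T.ker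
    rw [this]
    exact hT.finite_ker
  set a := star T * T with ha
  have hap : a * p = 0 := by rw [ha, mul_assoc, hTp, mul_zero]
  have hpa : p * a = 0 := by rw [ha, ← mul_assoc, hpT, zero_mul]
  have hu : IsUnit (a + p) := by
    -- `c ^ 2` is the lower bound of `T*T` on the complement of the kernel, 1 that of `p` on the
    -- kernel.
    have hm : 0 < min (c ^ 2) 1 := lt_min (by positivity) one_pos
    refine ContinuousLinearMap.isUnit_of_forall_le_norm_inner_map (a + p)
      (c := ⟨min (c ^ 2) 1, hm.le⟩) hm fun v => ?_
    have h1 : inner ℂ ((a + p) v) v = ((‖T v‖ ^ 2 + ‖p v‖ ^ 2 : ℝ) : ℂ) := by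
      have h2 : inner ℂ (a v) v = ((‖T v‖ ^ 2 : ℝ) : ℂ) := by
        change inner ℂ (ContinuousLinearMap.adjoint T (T v)) v = _
        rw [ContinuousLinearMap.adjoint_inner_left, inner_self_eq_norm_sq_to_K]
        push_cast
        rfl
      have h3 : inner ℂ (p v) v = ((‖p v‖ ^ 2 : ℝ) : ℂ) := by
        have h4 : p v = ContinuousLinearMap.adjoint p (p v) := by
          rw [← ContinuousLinearMap.star_eq_adjoint, hps]
          exact (congrArg (fun S : H →L[ℂ] H => S v) hpp).symm
        conv_lhs => rw [h4]
        rw [ContinuousLinearMap.adjoint_inner_left, inner_self_eq_norm_sq_to_K]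
        push_cast
        rfl
      rw [_root_.add_apply, inner_add_left, h2, h3, ← Complex.ofReal_add]
    rw [h1, Complex.norm_real, Real.norm_of_nonneg (by positivity)]
    have h2 := Submodule.norm_sq_eq_add_norm_sq_starProjection v T.ker
    have h3 : T.kerᗮ.starProjection v ∈ T.kerᗮ := Submodule.starProjection_apply_mem _ v
    have h4 : T (T.kerᗮ.starProjection v) = T v := by
      have h5 := Submodule.starProjection_add_starProjection_orthogonal (K := T.ker) v
      have h6 : T (T.ker.starProjection v) = 0 := Submodule.starProjection_apply_mem T.ker v
      conv_rhs => rw [← h5]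
      rw [map_add, h6, zero_add]
    have h5 := pow_le_pow_left₀ (by positivity) (hbound _ h3) 2
    rw [h4, mul_pow] at h5
    rw [h2]
    change (‖p v‖ ^ 2 + ‖T.kerᗮ.starProjection v‖ ^ 2) * min (c ^ 2) 1 ≤ _
    have h6 := mul_le_mul_of_nonneg_left (min_le_right (c ^ 2) 1) (sq_nonneg ‖p v‖)
    have h7 := mul_le_mul_of_nonneg_left (min_le_left (c ^ 2) 1)
      (sq_nonneg ‖T.kerᗮ.starProjection v‖)
    linarith
  obtain ⟨d, hd1, hd2⟩ := isUnit_iff_exists.1 hu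
  have hdp : d * p = p := by
    have h1 : (a + p) * p = p := by rw [add_mul, hap, hpp, zero_add]
    calc d * p = d * ((a + p) * p) := by rw [h1]
      _ = p := by rw [← mul_assoc, hd2, one_mul]
  have hpd : p * d = p := by
    have h1 : p * (a + p) = p := by rw [mul_add, hpa, hpp, zero_add]
    calc p * d = p * (a + p) * d := by rw [h1]
      _ = p := by rw [mul_assoc, hd1, mul_one]
  refine ⟨d - p, p, hpc, hTp, ?_, ?_, hpa, ?_, ?_⟩
  · rw [mul_sub, hap, sub_zero, ← hd1, add_mul, hpd]; abel
  · rw [sub_mul, hpa, sub_zero, ← hd2, mul_add, hdp]; abel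
  · rw [sub_mul, hdp, hpp, sub_self]
  · rw [mul_sub, hpd, hpp, sub_self]

end Fredholm

/-! ### Generalized and Fredholm inverses within spectrally invariant subalgebras -/

section SumHom

variable {G : Type*} [Group G]

/-- Generalized inverses of images of elements of a spectrally invariant closed `*`-subalgebra of
`ℓ¹(G; A)` are images of elements of it. -/
theorem EllOne.exists_map_eq_of_generalized_inverse {A : Type*}
    [NormedRing A] [NormedAlgebra ℂ A] [CompleteSpace A] [StarRing A] [NormedStarGroup A]
    [StarModule ℂ A] {D : StarSubalgebra ℂ (EllOne G A)}
    (hD : IsClosed (D : Set (EllOne G A)))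
    (hunit : ∀ d : D, IsUnit (EllOne.sumHom (d : EllOne G A)) → IsUnit d)
    {f : EllOne G A} (hfD : f ∈ D) {b p : A} (hab : EllOne.sumHom f * b = 1 - p)
    (hba : b * EllOne.sumHom f = 1 - p) (hap : EllOne.sumHom f * p = 0)
    (hpa : p * EllOne.sumHom f = 0) (hbp : b * p = 0) (hpb : p * b = 0) :
    ∃ s ∈ D, EllOne.sumHom s = b := by
  have : CompleteSpace D := hD.completeSpace_coe
  obtain ⟨s, hs⟩ := _root_.exists_map_eq_of_generalized_inverse
    (EllOne.sumHom.comp D.subtype).toAlgHom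
    (EllOne.continuous_sumHom.comp continuous_subtype_val) hunit (f := ⟨f, hfD⟩) rfl
    hab hba hap hpa hbp hpb
  exact ⟨s, s.2, hs⟩

/-- The image in `𝔹(H)` of a spectrally invariant closed `*`-subalgebra of `ℓ¹(G; 𝔹(H))` is
Fredholm inverse closed. -/
theorem EllOne.exists_fredholm_inverse {H : Type*} [NormedAddCommGroup H]
    [InnerProductSpace ℂ H] [CompleteSpace H] {D : StarSubalgebra ℂ (EllOne G (H →L[ℂ] H))}
    (hD : IsClosed (D : Set (EllOne G (H →L[ℂ] H))))
    (hunit : ∀ d : D, IsUnit (EllOne.sumHom (d : EllOne G (H →L[ℂ] H))) → IsUnit d)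
    {f : EllOne G (H →L[ℂ] H)} (hfD : f ∈ D) (hf : (EllOne.sumHom f).IsFredholm) :
    ∃ s ∈ D, IsCompactOperator (EllOne.sumHom s * EllOne.sumHom f - 1 : H →L[ℂ] H) ∧
      IsCompactOperator (EllOne.sumHom f * EllOne.sumHom s - 1 : H →L[ℂ] H) := by
  obtain ⟨b, p, hpc, hTp, hab, hba, hpa, hbp, hpb⟩ := hf.exists_generalized_inverse
  have hmap : EllOne.sumHom (star f * f) = star (EllOne.sumHom f) * EllOne.sumHom f := by
    rw [map_mul, map_star]
  obtain ⟨s, hsD, hs⟩ := EllOne.exists_map_eq_of_generalized_inverse hD hunit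
    (mul_mem (star_mem hfD) hfD) (hmap ▸ hab) (hmap ▸ hba)
    (by rw [hmap, mul_assoc, hTp, mul_zero]) (hmap ▸ hpa) hbp hpb
  have hs' : EllOne.sumHom (s * star f) = b * star (EllOne.sumHom f) := by
    rw [map_mul, map_star, hs]
  -- With `T = sumHom f` and `S = b T*`: `ST - 1 = -p`, while `(TS - 1)T = T(1 - p) - T = 0`, so `TS
  -- - 1` vanishes on a range of finite codimension.
  refine ⟨s * star f, mul_mem hsD (star_mem hfD), ?_, ?_⟩
  · rw [hs', mul_assoc, hba, sub_sub_cancel_left]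
    exact hpc.neg
  · refine isCompactOperator_of_mul_eq_zero hf.finite_coker ?_
    rw [hs', sub_mul, one_mul, mul_assoc, mul_assoc, hba, mul_sub, mul_one, hTp, sub_zero, sub_self]

end SumHom

end

theorem mainTheorem12 {G : Type*} [Group G] (hamen : IsAmenableGroup G)
    (hsymm : IsRigidlySymmetric G)
    (A : StarSubalgebra ℂ (EllInfty G)) (hAclosed : IsClosed (A : Set (EllInfty G)))
    (hAtrans : ∀ (x : G), ∀ φ ∈ A, leftTranslate x φ ∈ A)
    (ω : G → G → EllInfty G) (hω : IsTwoCocycle ω) (hωA : ∀ x y, ω x y ∈ A) :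
    (∀ K ∈ twistedKernels A, ∃ T : EllTwo G →L[ℂ] EllTwo G, IsTwistedIntegralOperator ω K T) ∧
    ∃ F : StarSubalgebra ℂ (EllTwo G →L[ℂ] EllTwo G),
      (F : Set (EllTwo G →L[ℂ] EllTwo G)) = twistedIntegralOperators A ω ∧
      IsInverseClosed F ∧ IsFredholmInverseClosed F := by
  let F : StarSubalgebra ℂ (EllTwo G →L[ℂ] EllTwo G) :=
    (twistedAlgebra A hAclosed hAtrans hω hωA).map EllOne.sumHom
  refine ⟨fun K hK => ?_, F, Set.ext fun T =>
    (mem_twistedIntegralOperators_iff hAclosed hAtrans hω hωA).symm, ?_, ?_⟩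
  · obtain ⟨f, _, hf⟩ := exists_mem_twistedAlgebra hAclosed hAtrans hω hωA hK
    exact ⟨EllOne.sumHom f, hf⟩
  · rintro _ ⟨f, hf, rfl⟩ T h1 h2
    obtain ⟨g, hg⟩ := isUnit_iff_exists.1 (isUnit_of_sumHom hamen hsymm
      (⟨f, hf⟩ : twistedAlgebra A hAclosed hAtrans hω hωA) (isUnit_iff_exists.2 ⟨T, h1, h2⟩))
    have h3 : g.1 * f = 1 := congrArg Subtype.val hg.2
    have h4 : EllOne.sumHom g.1 * EllOne.sumHom f = 1 := by rw [← map_mul, h3, map_one]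
    exact ⟨g.1, g.2, left_inv_eq_right_inv h4 h1⟩
  · rintro _ ⟨f, hf, rfl⟩ hT
    obtain ⟨s, hs, hs1, hs2⟩ := EllOne.exists_fredholm_inverse
      (isClosed_twistedAlgebra hAclosed hAtrans hω hωA)
      (isUnit_of_sumHom hamen hsymm) hf hT
    exact ⟨EllOne.sumHom s, ⟨s, hs, rfl⟩, hs1, hs2⟩
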